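/- Let $n,k,k'\ge 0$ be integers, let $R=\mathbb R[x_1,\dots,x_n]$, and let $S\in R^{k\times k'}$ be a polynomial matrix, acting as a constant-coefficient differential operator, $x_i$ being replaced by $\partial_i$: $(Su)_i=\sum_{l=1}^{k'}S_{il}(\partial)u^l$. Assume that for each $l$ all entries of the $l$-th column of $S$ are homogeneous of degree $h_l$. Let $\Omega\subset\mathbb R^n$ be bounded, open and convex, and let $\mathcal U\subset\mathcal D'(\Omega)^{k'}$ be any class of vector fields (for instance $\mathcal U=\mathcal D'(\Omega)^{k'}$ or $\mathcal U=C^\infty(\Omega)^{k'}$). For $u_j\in C^\infty(\Omega)^{k'}$ and $u\in\mathcal U$, write $Su_j\overset{*}{\rightharpoonup}Su$ in $L^\infty(\Omega)^k$ if $Su_j,Su\in L^\infty(\Omega)^k$ ($Su$ taken in the sense of distributions) and $\int_\Omega Su_j\cdot g\,dx\to\int_\Omega Su\cdot g\,dx$ for all $g\in L^1(\Omega)^k$. Suppose that $S$ satisfies the following compactness assumption: whenever $u_j\in C^\infty(\Omega)^{k'}$, $u\in\mathcal U$ and $Su_j\overset{*}{\rightharpoonup}Su$ in $L^\infty(\Omega)^k$,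 there exist $\tilde u_j,\tilde u\in\mathcal D'(\Omega)^{k'}$ such that $S\tilde u_j=Su_j$ for all $j$, $S\tilde u=Su$, and, for each $l=1,\dots,k'$ and each multi-index $\alpha$ with $|\alpha|<h_l$, $\partial^\alpha\tilde u_j^l\to\partial^\alpha\tilde u^l$ in $L^\infty(\Omega)$ as $j\to\infty$ (that is, $\partial^\alpha\tilde u_j^l-\partial^\alpha\tilde u^l\in L^\infty(\Omega)$ for all $j$, with norm tending to $0$). Let $F\colon\mathbb R^k\to\mathbb R$ be continuous and such that, with $Q=(0,1)^n$, $$\int_Q \big(F(z+Su(x))-F(z)\big)\,dx\ge 0\qquad\text{for all } z\in\mathbb R^k,\ u\in C_c^\infty(Q)^{k'}.$$ Then for all $u_j\in C^\infty(\Omega)^{k'}$ and $u\in\mathcal U$ with $Su_j\overset{*}{\rightharpoonup}Su$ in $L^\infty(\Omega)^k$, the functions $F(Su_j)$ and $F(Su)$ are integrable on $\Omega$ and $$\liminf_{j\to\infty}\int_\Omega F(Su_j(x))\,dx\ \ge\ \int_\Omega F(Su(x))\,dx .$$ -/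

import Mathlib

open MeasureTheory Filter Topology TopologicalSpace
open scoped Distributions LineDeriv ContDiff ENNReal

noncomputable section

namespace SyzygyLSC

/-- The Euclidean space `ℝⁿ`. -/
abbrev Rn (n : ℕ) : Type := EuclideanSpace ℝ (Fin n)

/-! ### Polynomials as constant coefficient differential operators

The variable `x_i` stands for the `i`-th partial derivative. The definitions are written for an
arbitrary real vector space `X` with operators `D i` (the partial derivatives), so that the same
formula is used for functions and for distributions. -/

section Operators

variable {n k k' : ℕ} {X : Type*}

/-- `∂^α = ∂₁^{α₁} ⋯ ∂ₙ^{αₙ}`. -/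
def multiDeriv (D : Fin n → X → X) (α : Fin n →₀ ℕ) (f : X) : X :=
  (List.finRange n).foldr (fun i g => (D i)^[α i] g) f

/-- `p(∂) f = ∑_α p_α ∂^α f`. -/
def polyOp [AddCommGroup X] [Module ℝ X] (D : Fin n → X → X)
    (p : MvPolynomial (Fin n) ℝ) (f : X) : X :=
  ∑ α ∈ p.support, p.coeff α • multiDeriv D α f

/-- `(S u)_i = ∑_l S_{il}(∂) u_l`. -/
def matrixOp [AddCommGroup X] [Module ℝ X] (D : Fin n → X → X)
    (S : Matrix (Fin k) (Fin k') (MvPolynomial (Fin n) ℝ)) (u : Fin k' → X) : Fin k → X :=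
  fun i => ∑ l, polyOp D (S i l) (u l)

end Operators

/-- The classical `i`-th partial derivative of a function on `ℝⁿ`. -/
def partialFun {n : ℕ} (i : Fin n) (f : Rn n → ℝ) : Rn n → ℝ :=
  fun x => lineDeriv ℝ f x (EuclideanSpace.single i 1)

/-- The `i`-th partial derivative of a distribution on `Ω`. -/
def partialDist {n : ℕ} {Ω : Opens (Rn n)} (i : Fin n) (T : 𝓓'(Ω, ℝ)) : 𝓓'(Ω, ℝ) :=
  ∂_{(EuclideanSpace.single i 1 : Rn n)} T

/-- The classical action of `S` on vector fields, as a map `x ↦ (S u)(x) ∈ ℝᵏ`. -/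
def applyFun {n k k' : ℕ} (S : Matrix (Fin k) (Fin k') (MvPolynomial (Fin n) ℝ))
    (u : Fin k' → Rn n → ℝ) (x : Rn n) : Fin k → ℝ :=
  fun i => matrixOp partialFun S u i x

/-- The action of `S` on vectors of distributions on `Ω`. -/
def applyDist {n k k' : ℕ} {Ω : Opens (Rn n)}
    (S : Matrix (Fin k) (Fin k') (MvPolynomial (Fin n) ℝ))
    (U : Fin k' → 𝓓'(Ω, ℝ)) : Fin k → 𝓓'(Ω, ℝ) :=
  matrixOp partialDist S U

/-- The distribution `T` on `Ω` is given by the locally integrable function `f`. -/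
def IsGivenBy {n : ℕ} {Ω : Opens (Rn n)} (T : 𝓓'(Ω, ℝ)) (f : Rn n → ℝ) : Prop :=
  LocallyIntegrableOn f (Ω : Set (Rn n)) ∧
    ∀ φ : 𝓓(Ω, ℝ), T φ = ∫ x in (Ω : Set (Rn n)), f x * φ x

/-- Weak-* convergence `v_j ⇀* v` in `L^∞(Ω)ᵏ`. -/
def WeakStarTendsto {n k : ℕ} (Ω : Opens (Rn n)) (v : ℕ → Rn n → Fin k → ℝ)
    (v₀ : Rn n → Fin k → ℝ) : Prop :=
  (∀ j, MemLp (v j) ∞ (volume.restrict (Ω : Set (Rn n)))) ∧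
  MemLp v₀ ∞ (volume.restrict (Ω : Set (Rn n))) ∧
  ∀ g : Rn n → Fin k → ℝ, MemLp g 1 (volume.restrict (Ω : Set (Rn n))) →
    Tendsto (fun j => ∫ x in (Ω : Set (Rn n)), v j x ⬝ᵥ g x) atTop
      (𝓝 (∫ x in (Ω : Set (Rn n)), v₀ x ⬝ᵥ g x))

/-- `T_j → T` in `L^∞(Ω)`, for distributions on `Ω`: the differences `T_j - T` are functions
in `L^∞(Ω)` whose norms tend to `0`. -/
def LinftyTendsto {n : ℕ} {Ω : Opens (Rn n)} (T : ℕ → 𝓓'(Ω, ℝ)) (T₀ : 𝓓'(Ω, ℝ)) : Prop :=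
  ∃ f : ℕ → Rn n → ℝ,
    (∀ j, MemLp (f j) ∞ (volume.restrict (Ω : Set (Rn n))) ∧ IsGivenBy (T j - T₀) (f j)) ∧
    Tendsto (fun j => eLpNorm (f j) ∞ (volume.restrict (Ω : Set (Rn n)))) atTop (𝓝 0)

/-- `u_j ∈ C^∞(Ω)^{k'}`, `U ∈ 𝓓'(Ω)^{k'}`, the distribution `S U` is the function `v`, and
`S u_j ⇀* S U = v` in `L^∞(Ω)ᵏ`. -/
structure ImageTendsto {n k k' : ℕ} (S : Matrix (Fin k) (Fin k') (MvPolynomial (Fin n) ℝ))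
    (Ω : Opens (Rn n)) (u : ℕ → Fin k' → Rn n → ℝ) (U : Fin k' → 𝓓'(Ω, ℝ))
    (v : Rn n → Fin k → ℝ) : Prop where
  smooth : ∀ j l, ContDiffOn ℝ ∞ (u j l) (Ω : Set (Rn n))
  limit : ∀ i, IsGivenBy (applyDist S U i) (fun x => v x i)
  weakStar : WeakStarTendsto Ω (fun j => applyFun S (u j)) v

/-- The compactness assumption on `S`, whose `l`-th column has order `h l`, for limits `U` taken
from a class `𝒰` of vectors of distributions on `Ω`: whenever `S u_j ⇀* S U` in `L^∞(Ω)ᵏ` with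
`u_j` smooth and `U ∈ 𝒰`, there are potentials `ũ_j`, `ũ` with `S ũ_j = S u_j`, `S ũ = S U` and
`∂^α ũ_j^l → ∂^α ũ^l` in `L^∞(Ω)` for all `l` and all `|α| < h l`. -/
def CompactnessAssumption {n k k' : ℕ} (S : Matrix (Fin k) (Fin k') (MvPolynomial (Fin n) ℝ))
    (h : Fin k' → ℕ) (Ω : Opens (Rn n)) (𝒰 : Set (Fin k' → 𝓓'(Ω, ℝ))) : Prop :=
  ∀ (u : ℕ → Fin k' → Rn n → ℝ) (U : Fin k' → 𝓓'(Ω, ℝ)) (v : Rn n → Fin k → ℝ),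
    U ∈ 𝒰 → ImageTendsto S Ω u U v →
    ∃ (u' : ℕ → Fin k' → 𝓓'(Ω, ℝ)) (U' : Fin k' → 𝓓'(Ω, ℝ)),
      (∀ j i, IsGivenBy (applyDist S (u' j) i) (fun x => applyFun S (u j) x i)) ∧
      applyDist S U' = applyDist S U ∧
      ∀ (l : Fin k') (α : Fin n →₀ ℕ), α.degree < h l →
        LinftyTendsto (fun j => multiDeriv partialDist α (u' j l))
          (multiDeriv partialDist α (U' l))

/-- The open unit cube `Q = (0,1)ⁿ`. -/
def unitCube (n : ℕ) : Opens (Rn n) where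
  carrier := {x | ∀ i, x i ∈ Set.Ioo (0 : ℝ) 1}
  is_open' := by
    simp only [Set.ofPred_forall]
    exact isOpen_iInter_of_finite fun i => isOpen_Ioo.preimage (by fun_prop)

/-- `∫_Q F(z + S u(x)) - F(z) dx ≥ 0` for all `z ∈ ℝᵏ` and `u ∈ C_c^∞(Q)^{k'}`. -/
def Quasiconvex {n k k' : ℕ} (S : Matrix (Fin k) (Fin k') (MvPolynomial (Fin n) ℝ))
    (F : (Fin k → ℝ) → ℝ) : Prop :=
  ∀ (z : Fin k → ℝ) (u : Fin k' → 𝓓(unitCube n, ℝ)),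
    0 ≤ ∫ x in (unitCube n : Set (Rn n)), (F (z + applyFun S (fun l => ⇑(u l)) x) - F z)

end SyzygyLSC

end

/-! By Banach–Steinhaus, weak-* convergence bounds `S u_j` and `v = S U` uniformly, so only the
values of `F` on a ball matter, where `F` is uniformly continuous. The compactness assumption gives
`S u_j - v = S w_j` with `w_j = u'_j - U'`, all derivatives of `w_j l` of order less than `h l`
tending uniformly to `0`. Replacing `v` by a step function
(`eventually_integral_ge_of_forall_const`) reduces the claim to `liminf ∫_A F(z + S w_j) ≥ ∫_A F(z)`
for constant `z` and measurable `A ⊆ Ω`.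

For that, take a cut-off `φ` that equals `1` on most of `A` and is supported little beyond it. Since
`S i l` is homogeneous of degree `h l`, the commutator of `S` with multiplication by `φ` involves
only derivatives of `w_j l` of order less than `h l`. Hence `S (φ w_j)` is uniformly close to `φ S
w_j`. After mollification `φ w_j` is essentially a test field, and quasiconvexity, rescaled from the
cube to arbitrary compact supports, gives the inequality up to a vanishing error
(`Quasiconvex.integral_cutoff_ge`, `Quasiconvex.eventually_setIntegral_ge`).

Columns with `h l = 0` need separate care in `exists_testField`: nothing is known about `w_j l`,
which may be a mere distribution. There `S` acts by a constant matrix `A`, and a matrix `B` with `A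
B A = A` recovers a smooth substitute from the known right-hand side. -/

noncomputable section

namespace SyzygyLSC

/-! ### Multi-indices as sorted lists of directions -/

/-- The sorted list in which each `i` occurs `α i` times. -/
def multiList {n : ℕ} (α : Fin n →₀ ℕ) : List (Fin n) :=
  (List.finRange n).flatMap fun i => List.replicate (α i) i

theorem multiDeriv_eq_foldr {n : ℕ} {X : Type*} (D : Fin n → X → X) (α : Fin n →₀ ℕ) (f : X) :
    multiDeriv D α f = (multiList α).foldr D f := by
  have key : ∀ L : List (Fin n), L.foldr (fun i g => (D i)^[α i] g) f =
      (L.flatMap fun i => List.replicate (α i) i).foldr D f := by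
    intro L
    induction L with
    | nil => rfl
    | cons i L ih =>
      have hrep : ∀ (m : ℕ) (g : X), (List.replicate m i).foldr D g = (D i)^[m] g := by
        intro m
        induction m with
        | zero => intro g; rfl
        | succ m ihm =>
          intro g
          rw [List.replicate_succ, List.foldr_cons, ihm, Function.iterate_succ_apply']
      rw [List.foldr_cons, List.flatMap_cons, List.foldr_append, ← ih, hrep]
  exact key _

theorem count_multiList {n : ℕ} (α : Fin n →₀ ℕ) (i : Fin n) :
    (multiList α).count i = α i := by
  have key : ∀ L : List (Fin n), L.Nodup →
      (L.flatMap fun j => List.replicate (α j) j).count i = if i ∈ L then α i else 0 := by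
    intro L
    induction L with
    | nil => simp
    | cons j L ih =>
      intro hL
      rw [List.nodup_cons] at hL
      rw [List.flatMap_cons, List.count_append, ih hL.2, List.count_replicate]
      by_cases hij : j = i
      · subst hij
        simp [hL.1]
      · simp [hij, Ne.symm hij]
  rw [multiList, key _ (List.nodup_finRange n), if_pos (List.mem_finRange i)]

theorem length_multiList {n : ℕ} (α : Fin n →₀ ℕ) : (multiList α).length = α.degree := by
  rw [Finsupp.degree_eq_sum, multiList, List.length_flatMap]
  simp only [List.length_replicate]
  rw [← List.sum_ofFn, List.ofFn_eq_map]

theorem pairwise_multiList {n : ℕ} (α : Fin n →₀ ℕ) : (multiList α).Pairwise (· ≤ ·) := by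
  rw [multiList, List.pairwise_flatMap]
  refine ⟨fun i _ => ?_, ?_⟩
  · exact List.pairwise_replicate.2 (Or.inr le_rfl)
  · refine (List.pairwise_le_finRange n).imp ?_
    intro a b hab x hx y hy
    rw [List.eq_of_mem_replicate hx, List.eq_of_mem_replicate hy]
    exact hab

/-- A sorted list is determined by its multiplicities. The lists in the Leibniz rule are sublists of
a sorted list, so they are multi-indices again. -/
theorem exists_multiList_eq {n : ℕ} {L : List (Fin n)} (hL : L.Pairwise (· ≤ ·)) :
    ∃ β : Fin n →₀ ℕ, multiList β = L := by
  refine ⟨Finsupp.equivFunOnFinite.symm fun i => L.count i, ?_⟩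
  refine List.Perm.eq_of_pairwise' (pairwise_multiList _) hL ?_
  rw [List.perm_iff_count]
  intro i
  rw [count_multiList]
  rfl

/-! ### Partial derivatives of smooth functions -/

section Smooth

variable {n : ℕ} {f g : Rn n → ℝ}

theorem partialFun_eq_fderiv (hf : ContDiff ℝ ∞ f) (i : Fin n) :
    partialFun i f = fun x => fderiv ℝ f x (EuclideanSpace.single i 1) := by
  funext x
  exact ((hf.differentiable (by simp)) x).lineDeriv_eq_fderiv

theorem contDiff_partialFun (hf : ContDiff ℝ ∞ f) (i : Fin n) : ContDiff ℝ ∞ (partialFun i f) := by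
  rw [partialFun_eq_fderiv hf]
  exact (hf.fderiv_right (m := ∞) (by simp)).clm_apply contDiff_const

theorem contDiff_foldr_partialFun (hf : ContDiff ℝ ∞ f) (L : List (Fin n)) :
    ContDiff ℝ ∞ (L.foldr partialFun f) := by
  induction L with
  | nil => exact hf
  | cons i L ih => exact contDiff_partialFun ih i

theorem partialFun_comm (hf : ContDiff ℝ ∞ f) (i j : Fin n) :
    partialFun i (partialFun j f) = partialFun j (partialFun i f) := by
  have hd : Differentiable ℝ (fderiv ℝ f) :=
    (hf.fderiv_right (m := ∞) (by simp)).differentiable (by simp)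
  have key : ∀ a b : Fin n, ∀ x, partialFun a (partialFun b f) x =
      fderiv ℝ (fderiv ℝ f) x (EuclideanSpace.single a 1) (EuclideanSpace.single b 1) := by
    intro a b x
    rw [partialFun_eq_fderiv (contDiff_partialFun hf b), partialFun_eq_fderiv hf]
    dsimp only
    rw [fderiv_clm_apply (hd x) (differentiableAt_const _)]
    simp
  funext x
  rw [key, key]
  exact (hf.contDiffAt.isSymmSndFDerivAt (by simpa using (mod_cast le_top : ((2 : ℕ∞) : WithTop ℕ∞) ≤ ((⊤ : ℕ∞) : WithTop ℕ∞)))) _ _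

/-- Moves an innermost derivative outermost. Transposing distributional derivatives onto the kernel
reverses their order, and this restores it. -/
theorem foldr_partialFun_comm (hf : ContDiff ℝ ∞ f) (i : Fin n) (L : List (Fin n)) :
    L.foldr partialFun (partialFun i f) = partialFun i (L.foldr partialFun f) := by
  induction L with
  | nil => rfl
  | cons j L ih =>
    rw [List.foldr_cons, ih, List.foldr_cons, partialFun_comm (contDiff_foldr_partialFun hf L)]

theorem tsupport_partialFun_subset (i : Fin n) : tsupport (partialFun i f) ⊆ tsupport f := by
  have h : Function.support (partialFun i f) ⊆ tsupport f := by
    intro x hx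
    by_contra hxf
    apply hx
    have h0 : f =ᶠ[𝓝 x] fun _ => (0 : ℝ) := notMem_tsupport_iff_eventuallyEq.1 hxf
    rw [partialFun, h0.lineDeriv_eq]
    simp [lineDeriv]
  exact closure_minimal h (isClosed_tsupport f)

theorem tsupport_foldr_partialFun_subset (L : List (Fin n)) :
    tsupport (L.foldr partialFun f) ⊆ tsupport f := by
  induction L with
  | nil => exact subset_rfl
  | cons i L ih => exact (tsupport_partialFun_subset i).trans ih

theorem partialFun_add (hf : ContDiff ℝ ∞ f) (hg : ContDiff ℝ ∞ g) (i : Fin n) :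
    partialFun i (f + g) = partialFun i f + partialFun i g := by
  rw [partialFun_eq_fderiv hf, partialFun_eq_fderiv hg,
    partialFun_eq_fderiv (f := f + g) (hf.add hg)]
  funext x
  rw [fderiv_add (hf.differentiable (by simp) x) (hg.differentiable (by simp) x)]
  simp

theorem partialFun_mul (hf : ContDiff ℝ ∞ f) (hg : ContDiff ℝ ∞ g) (i : Fin n) :
    partialFun i (f * g) = partialFun i f * g + f * partialFun i g := by
  rw [partialFun_eq_fderiv hf, partialFun_eq_fderiv hg,
    partialFun_eq_fderiv (f := f * g) (hf.mul hg)]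
  funext x
  rw [fderiv_mul (hf.differentiable (by simp) x) (hg.differentiable (by simp) x)]
  simp
  ring

theorem partialFun_zero (i : Fin n) : partialFun i (0 : Rn n → ℝ) = 0 := by
  funext x
  simp [partialFun, lineDeriv]

theorem partialFun_const_smul (hf : ContDiff ℝ ∞ f) (a : ℝ) (i : Fin n) :
    partialFun i (a • f) = a • partialFun i f := by
  rw [partialFun_eq_fderiv hf, partialFun_eq_fderiv (f := a • f) (hf.const_smul a)]
  funext x
  rw [fderiv_const_smul (hf.differentiable (by simp) x)]
  simp

theorem foldr_partialFun_const_smul (hf : ContDiff ℝ ∞ f) (a : ℝ) (L : List (Fin n)) :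
    L.foldr partialFun (a • f) = a • L.foldr partialFun f := by
  induction L with
  | nil => rfl
  | cons i L ih =>
    rw [List.foldr_cons, ih, partialFun_const_smul (contDiff_foldr_partialFun hf L), List.foldr_cons]

theorem partialFun_comp_dilation (hf : ContDiff ℝ ∞ f) (r : ℝ) (c : Rn n) (i : Fin n) :
    partialFun i (fun x => f (r • (x - c))) = r • fun x => partialFun i f (r • (x - c)) := by
  have hA : ∀ x, HasFDerivAt (fun x : Rn n => r • (x - c)) (r • ContinuousLinearMap.id ℝ (Rn n)) x :=
    fun x => ((hasFDerivAt_id x).sub_const c).const_smul r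
  have hc : ContDiff ℝ ∞ fun x : Rn n => f (r • (x - c)) := hf.comp (by fun_prop)
  rw [partialFun_eq_fderiv hf, partialFun_eq_fderiv hc]
  funext x
  have h := ((hf.differentiable (by simp) (r • (x - c))).hasFDerivAt.comp x (hA x)).fderiv
  simp only [Function.comp_def] at h
  rw [h]
  simp

theorem foldr_partialFun_comp_dilation (hf : ContDiff ℝ ∞ f) (r : ℝ) (c : Rn n)
    (L : List (Fin n)) :
    L.foldr partialFun (fun x => f (r • (x - c))) =
      r ^ L.length • fun x => L.foldr partialFun f (r • (x - c)) := by
  induction L with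
  | nil => simp
  | cons i L ih =>
    have hL := contDiff_foldr_partialFun hf L
    have hc : ContDiff ℝ ∞ fun x : Rn n => L.foldr partialFun f (r • (x - c)) :=
      hL.comp (by fun_prop)
    rw [List.foldr_cons, ih, partialFun_const_smul hc,
      partialFun_comp_dilation hL, smul_smul, List.length_cons, pow_succ]
    rfl

/-- The Leibniz rule for an iterated partial derivative, without the explicit coefficients. -/
theorem exists_leibniz {φ : Rn n → ℝ} (hφ : ContDiff ℝ ∞ φ) (L : List (Fin n)) :
    ∃ T : List ((Rn n → ℝ) × List (Fin n)),
      (∀ p ∈ T, ContDiff ℝ ∞ p.1 ∧ tsupport p.1 ⊆ tsupport φ ∧ p.2.Sublist L ∧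
        p.2.length < L.length) ∧
      ∀ W : Rn n → ℝ, ContDiff ℝ ∞ W →
        L.foldr partialFun (φ * W) =
          φ * L.foldr partialFun W + (T.map fun p => p.1 * p.2.foldr partialFun W).sum := by
  induction L with
  | nil => exact ⟨[], by simp, fun W _ => by simp⟩
  | cons i L ih =>
    obtain ⟨T, hT, hTW⟩ := ih
    -- The new derivative falls on `φ` in the leading term, on the coefficient of an old remainder
    -- term, or on the factor containing `W`.
    refine ⟨(partialFun i φ, L) :: (T.map (fun p => (partialFun i p.1, p.2)) ++
      T.map (fun p => (p.1, i :: p.2))), ?_, ?_⟩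
    · intro p hp
      rcases List.mem_cons.1 hp with rfl | hp
      · exact ⟨contDiff_partialFun hφ i, tsupport_partialFun_subset i, List.sublist_cons_self i L,
          by simp⟩
      · rcases List.mem_append.1 hp with hp | hp <;> obtain ⟨q, hq, rfl⟩ := List.mem_map.1 hp <;>
          obtain ⟨h1, h2, h3, h4⟩ := hT q hq
        · exact ⟨contDiff_partialFun h1 i, (tsupport_partialFun_subset i).trans h2,
            h3.trans (List.sublist_cons_self i L), by simp; omega⟩
        · exact ⟨h1, h2, h3.cons_cons i, by simpa using h4⟩
    · intro W hW
      have hsum : ∀ T : List ((Rn n → ℝ) × List (Fin n)), (∀ p ∈ T, ContDiff ℝ ∞ p.1) →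
          ContDiff ℝ ∞ (T.map fun p => p.1 * p.2.foldr partialFun W).sum ∧
          partialFun i (T.map fun p => p.1 * p.2.foldr partialFun W).sum =
            (T.map fun p => partialFun i p.1 * p.2.foldr partialFun W).sum +
            (T.map fun p => p.1 * (i :: p.2).foldr partialFun W).sum := by
        intro T
        induction T with
        | nil =>
          intro _
          refine ⟨?_, ?_⟩
          · exact contDiff_const (c := (0 : ℝ))
          · simp [partialFun_zero]
        | cons q T ihT =>
          intro h
          obtain ⟨h1, h2⟩ := ihT fun p hp => h p (List.mem_cons_of_mem _ hp)
          have hq := h q List.mem_cons_self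
          have hqW := contDiff_foldr_partialFun hW q.2
          have hm : ContDiff ℝ ∞ (q.1 * q.2.foldr partialFun W) := hq.mul hqW
          refine ⟨?_, ?_⟩
          · rw [List.map_cons, List.sum_cons]
            exact hm.add h1
          · rw [List.map_cons, List.sum_cons, partialFun_add hm h1, h2,
              partialFun_mul hq hqW]
            simp only [List.map_cons, List.sum_cons, List.foldr_cons]
            ring
      obtain ⟨h1, h2⟩ := hsum T fun p hp => (hT p hp).1
      have hLW := contDiff_foldr_partialFun hW L
      have hm : ContDiff ℝ ∞ (φ * L.foldr partialFun W) := hφ.mul hLW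
      rw [List.foldr_cons, hTW W hW, partialFun_add hm h1, h2, partialFun_mul hφ hLW]
      simp only [List.map_cons, List.sum_cons, List.foldr_cons, List.map_append, List.sum_append,
        List.map_map, Function.comp_def]
      ring

end Smooth

/-! ### Polynomial operators on smooth functions -/

section PolyOp

variable {n k k' : ℕ} {f : Rn n → ℝ} {p : MvPolynomial (Fin n) ℝ} {m : ℕ}

theorem polyOp_apply (p : MvPolynomial (Fin n) ℝ) (f : Rn n → ℝ) (x : Rn n) :
    polyOp partialFun p f x = ∑ α ∈ p.support, p.coeff α * multiDeriv partialFun α f x := by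
  simp [polyOp, Finset.sum_apply]

theorem contDiff_multiDeriv (hf : ContDiff ℝ ∞ f) (α : Fin n →₀ ℕ) :
    ContDiff ℝ ∞ (multiDeriv partialFun α f) := by
  rw [multiDeriv_eq_foldr]
  exact contDiff_foldr_partialFun hf _

theorem contDiff_polyOp (hf : ContDiff ℝ ∞ f) (p : MvPolynomial (Fin n) ℝ) :
    ContDiff ℝ ∞ (polyOp partialFun p f) := by
  have h : polyOp partialFun p f =
      fun x => ∑ α ∈ p.support, p.coeff α * multiDeriv partialFun α f x :=
    funext (polyOp_apply p f)
  rw [h]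
  exact ContDiff.sum fun α _ => contDiff_const.mul (contDiff_multiDeriv hf α)

theorem polyOp_eq_zero_of_notMem_tsupport {x : Rn n} (hx : x ∉ tsupport f)
    (p : MvPolynomial (Fin n) ℝ) : polyOp partialFun p f x = 0 := by
  rw [polyOp_apply]
  refine Finset.sum_eq_zero fun α _ => ?_
  rw [multiDeriv_eq_foldr,
    image_eq_zero_of_notMem_tsupport fun h => hx (tsupport_foldr_partialFun_subset _ h), mul_zero]

theorem polyOp_const_smul (hf : ContDiff ℝ ∞ f) (a : ℝ) (p : MvPolynomial (Fin n) ℝ) :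
    polyOp partialFun p (a • f) = a • polyOp partialFun p f := by
  simp only [polyOp, multiDeriv_eq_foldr, foldr_partialFun_const_smul hf, Finset.smul_sum]
  exact Finset.sum_congr rfl fun α _ => smul_comm _ _ _

theorem degree_eq_of_mem_support (hp : p.IsHomogeneous m) {α : Fin n →₀ ℕ} (hα : α ∈ p.support) :
    α.degree = m := by
  rw [Finsupp.degree_eq_weight_one]
  exact hp (MvPolynomial.mem_support_iff.1 hα)

theorem polyOp_comp_dilation (hp : p.IsHomogeneous m) (hf : ContDiff ℝ ∞ f) (r : ℝ) (c : Rn n) :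
    polyOp partialFun p (fun x => f (r • (x - c))) =
      r ^ m • fun x => polyOp partialFun p f (r • (x - c)) := by
  funext x
  rw [Pi.smul_apply, polyOp_apply, polyOp_apply, Finset.smul_sum]
  refine Finset.sum_congr rfl fun α hα => ?_
  rw [multiDeriv_eq_foldr, multiDeriv_eq_foldr, foldr_partialFun_comp_dilation hf,
    length_multiList, degree_eq_of_mem_support hp hα]
  simp only [Pi.smul_apply, smul_eq_mul]
  ring

theorem multiDeriv_zero {X : Type*} (D : Fin n → X → X) (f : X) : multiDeriv D 0 f = f := by
  have h : multiList (0 : Fin n →₀ ℕ) = [] :=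
    List.length_eq_zero_iff.1 (by rw [length_multiList]; simp)
  rw [multiDeriv_eq_foldr, h]
  rfl

theorem polyOp_of_isHomogeneous_zero (hp : p.IsHomogeneous 0) {X : Type*} [AddCommGroup X]
    [Module ℝ X] (D : Fin n → X → X) (f : X) : polyOp D p f = p.coeff 0 • f := by
  have hsub : p.support ⊆ {0} := by
    intro α hα
    rw [Finset.mem_singleton, ← Finsupp.degree_eq_zero_iff]
    exact degree_eq_of_mem_support hp hα
  rw [polyOp, Finset.sum_subset hsub, Finset.sum_singleton, multiDeriv_zero]
  intro α _ hα
  rw [MvPolynomial.notMem_support_iff.1 hα, zero_smul]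

/-- The Leibniz coefficients are continuous with support in that of `φ`, hence bounded, and each
multiplies a derivative of `W` of lower order. The constant depends on `φ` and `α` but not on `W`,
so it is uniform along sequences. -/
theorem exists_multiDeriv_mul_bound {φ : Rn n → ℝ} (hφ : ContDiff ℝ ∞ φ)
    (hφc : HasCompactSupport φ) (α : Fin n →₀ ℕ) :
    ∃ C, 0 ≤ C ∧ ∀ W : Rn n → ℝ, ContDiff ℝ ∞ W → ∀ (x : Rn n) (ε : ℝ), 0 ≤ ε →
      (∀ β : Fin n →₀ ℕ, β.degree < α.degree → |multiDeriv partialFun β W x| ≤ ε) →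
      |multiDeriv partialFun α (φ * W) x - φ x * multiDeriv partialFun α W x| ≤ C * ε := by
  obtain ⟨T, hT, hTW⟩ := exists_leibniz hφ (multiList α)
  have key : ∀ T : List ((Rn n → ℝ) × List (Fin n)),
      (∀ p ∈ T, ContDiff ℝ ∞ p.1 ∧ tsupport p.1 ⊆ tsupport φ ∧ p.2.Sublist (multiList α) ∧
        p.2.length < (multiList α).length) →
      ∃ C, 0 ≤ C ∧ ∀ W : Rn n → ℝ, ∀ (x : Rn n) (ε : ℝ), 0 ≤ ε →
      (∀ β : Fin n →₀ ℕ, β.degree < α.degree → |multiDeriv partialFun β W x| ≤ ε) →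
      |(T.map fun p => p.1 * p.2.foldr partialFun W).sum x| ≤ C * ε := by
    intro T
    induction T with
    | nil => exact fun _ => ⟨0, le_rfl, fun W x ε _ _ => by simp⟩
    | cons q T ih =>
      intro h
      obtain ⟨C, hC, hb⟩ := ih fun p hp => h p (List.mem_cons_of_mem _ hp)
      obtain ⟨h1, h2, h3, h4⟩ := h q List.mem_cons_self
      have hqc : HasCompactSupport q.1 := hφc.of_isClosed_subset (isClosed_tsupport _) h2
      obtain ⟨Cq, hCq⟩ := h1.continuous.bounded_above_of_compact_support hqc
      obtain ⟨β, hβ⟩ := exists_multiList_eq ((pairwise_multiList α).sublist h3)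
      refine ⟨Cq + C, add_nonneg ((norm_nonneg _).trans (hCq 0)) hC, fun W x ε hε hW => ?_⟩
      have hdeg : β.degree < α.degree := by
        rw [← length_multiList, ← length_multiList, hβ]
        exact h4
      have hq := hW β hdeg
      rw [multiDeriv_eq_foldr, hβ] at hq
      rw [List.map_cons, List.sum_cons, Pi.add_apply, Pi.mul_apply, add_mul]
      refine (abs_add_le _ _).trans (add_le_add ?_ (hb W x ε hε hW))
      rw [abs_mul]
      exact mul_le_mul (hCq x) hq (abs_nonneg _) ((norm_nonneg _).trans (hCq 0))
  obtain ⟨C, hC, hb⟩ := key T hT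
  refine ⟨C, hC, fun W hW x ε hε hWx => ?_⟩
  rw [multiDeriv_eq_foldr partialFun α (φ * W), multiDeriv_eq_foldr partialFun α W, hTW W hW]
  simpa using hb W x ε hε hWx

/-- The commutator of `p(∂)`, with `p` homogeneous of degree `m`, and multiplication by a cut-off
function is controlled by the derivatives of order less than `m`. -/
theorem exists_polyOp_mul_bound (hp : p.IsHomogeneous m) {φ : Rn n → ℝ} (hφ : ContDiff ℝ ∞ φ)
    (hφc : HasCompactSupport φ) :
    ∃ C, 0 ≤ C ∧ ∀ W : Rn n → ℝ, ContDiff ℝ ∞ W → ∀ (x : Rn n) (ε : ℝ), 0 ≤ ε →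
      (∀ β : Fin n →₀ ℕ, β.degree < m → |multiDeriv partialFun β W x| ≤ ε) →
      |polyOp partialFun p (φ * W) x - φ x * polyOp partialFun p W x| ≤ C * ε := by
  choose C hC hb using fun α => exists_multiDeriv_mul_bound hφ hφc α
  refine ⟨∑ α ∈ p.support, |p.coeff α| * C α,
    Finset.sum_nonneg fun α _ => mul_nonneg (abs_nonneg _) (hC α), fun W hW x ε hε hWx => ?_⟩
  rw [polyOp_apply, polyOp_apply, Finset.mul_sum, ← Finset.sum_sub_distrib, Finset.sum_mul]
  refine (Finset.abs_sum_le_sum_abs _ _).trans (Finset.sum_le_sum fun α hα => ?_)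
  have h := hb α W hW x ε hε fun β hβ => hWx β (by rwa [degree_eq_of_mem_support hp hα] at hβ)
  calc _ = |p.coeff α| *
        |multiDeriv partialFun α (φ * W) x - φ x * multiDeriv partialFun α W x| := by
        rw [← abs_mul]; congr 1; ring
    _ ≤ |p.coeff α| * (C α * ε) := mul_le_mul_of_nonneg_left h (abs_nonneg _)
    _ = _ := by ring

theorem applyFun_apply (S : Matrix (Fin k) (Fin k') (MvPolynomial (Fin n) ℝ))
    (u : Fin k' → Rn n → ℝ) (x : Rn n) (i : Fin k) :
    applyFun S u x i = ∑ l, polyOp partialFun (S i l) (u l) x := by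
  simp [applyFun, matrixOp, Finset.sum_apply]

end PolyOp

/-! ### Quasiconvexity on the whole space -/

/-- By scaling and translation, the quasiconvexity inequality holds for test fields with
arbitrary compact support. -/
theorem Quasiconvex.integral_nonneg {n k k' : ℕ}
    {S : Matrix (Fin k) (Fin k') (MvPolynomial (Fin n) ℝ)} {h : Fin k' → ℕ}
    (hS : ∀ i l, (S i l).IsHomogeneous (h l)) {F : (Fin k → ℝ) → ℝ} (hqc : Quasiconvex S F)
    (z : Fin k → ℝ) (w : Fin k' → Rn n → ℝ) (hw : ∀ l, ContDiff ℝ ∞ (w l))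
    (hwc : ∀ l, HasCompactSupport (w l)) :
    0 ≤ ∫ x, (F (z + applyFun S w x) - F z) := by
  obtain ⟨R, hR, hsupp⟩ : ∃ R : ℝ, 0 < R ∧ ∀ l, tsupport (w l) ⊆ Metric.closedBall 0 R := by
    have hb : Bornology.IsBounded (⋃ l, tsupport (w l)) :=
      Bornology.isBounded_iUnion.2 fun l => (hwc l).isCompact.isBounded
    obtain ⟨R, hR, hsub⟩ := hb.subset_closedBall_lt 0 0
    exact ⟨R, hR, fun l => (Set.subset_iUnion _ l).trans hsub⟩
  let c : Rn n := WithLp.toLp 2 fun _ => (1 / 2 : ℝ)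
  -- The dilation shrinks the ball of radius `R` to radius `1/4`, which fits in the cube around its
  -- centre `c`.
  let r : ℝ := 4 * R
  have hr : 0 < r := by positivity
  have hball : Metric.closedBall c (1 / 4) ⊆ (unitCube n : Set (Rn n)) := by
    intro x hx i
    have h1 : ‖(x - c) i‖ ≤ 1 / 4 :=
      (PiLp.norm_apply_le (x - c) i).trans (by rwa [← dist_eq_norm])
    have h2 : (x - c) i = x i - 1 / 2 := rfl
    rw [h2, Real.norm_eq_abs, abs_le] at h1
    constructor <;> linarith
  have hout : ∀ x, x ∉ Metric.closedBall c (1 / 4) → ∀ l, r • (x - c) ∉ tsupport (w l) := by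
    intro x hx l hxl
    apply hx
    have h1 := hsupp l hxl
    rw [mem_closedBall_zero_iff, norm_smul, Real.norm_eq_abs, abs_of_pos hr] at h1
    rw [Metric.mem_closedBall, dist_eq_norm]
    have : R * (4 * ‖x - c‖) ≤ R * 1 := by simp only [r] at h1; linarith
    linarith [le_of_mul_le_mul_left this hR]
  -- The factor cancels the `r ^ h l` produced by differentiation. It depends on `l` alone because
  -- the degree is constant along each column.
  let q : Fin k' → Rn n → ℝ := fun l => (r ^ h l)⁻¹ • fun x => w l (r • (x - c))
  have hwd : ∀ l, ContDiff ℝ ∞ fun x : Rn n => w l (r • (x - c)) := fun l =>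
    (hw l).comp (by fun_prop)
  have hqs : ∀ l, tsupport (q l) ⊆ Metric.closedBall c (1 / 4) := by
    intro l
    refine closure_minimal ?_ Metric.isClosed_closedBall
    intro x hx
    by_contra hxc
    apply hx
    simp only [q, Pi.smul_apply]
    rw [image_eq_zero_of_notMem_tsupport (hout x hxc l), smul_zero]
  let u : Fin k' → 𝓓(unitCube n, ℝ) := fun l =>
    ⟨q l, (hwd l).const_smul (r ^ h l)⁻¹,
      HasCompactSupport.of_support_subset_isCompact (isCompact_closedBall c (1 / 4))
        ((subset_tsupport _).trans (hqs l)), (hqs l).trans hball⟩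
  have happ : ∀ x, applyFun S (fun l => ⇑(u l)) x = applyFun S w (r • (x - c)) := by
    intro x
    funext i
    rw [applyFun_apply, applyFun_apply]
    refine Finset.sum_congr rfl fun l _ => ?_
    change polyOp partialFun (S i l) (q l) x = _
    rw [polyOp_const_smul (hwd l), polyOp_comp_dilation (hS i l) (hw l), smul_smul,
      inv_mul_cancel₀ (pow_ne_zero _ hr.ne'), one_smul]
  have h0 := hqc z u
  simp only [happ] at h0
  let G : Rn n → ℝ := fun x => F (z + applyFun S w x) - F z
  have hG : ∫ x in (unitCube n : Set (Rn n)), G (r • (x - c)) = ∫ x, G (r • (x - c)) := by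
    refine setIntegral_eq_integral_of_forall_compl_eq_zero fun x hx => ?_
    have hx' := hout x fun hxb => hx (hball hxb)
    have : applyFun S w (r • (x - c)) = 0 := by
      funext i
      rw [applyFun_apply]
      exact Finset.sum_eq_zero fun l _ => polyOp_eq_zero_of_notMem_tsupport (hx' l) _
    simp only [G, this, add_zero, sub_self]
  change 0 ≤ ∫ x in (unitCube n : Set (Rn n)), G (r • (x - c)) at h0
  rw [hG, integral_sub_right_eq_self (fun x => G (r • x)) c, Measure.integral_comp_smul] at h0
  have hpos : 0 < |(r ^ Module.finrank ℝ (Rn n))⁻¹| := abs_pos.2 (inv_ne_zero (pow_ne_zero _ hr.ne'))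
  exact nonneg_of_mul_nonneg_right h0 hpos

/-! ### Mollification -/

section Mollification

variable {n : ℕ} {ρ g : Rn n → ℝ}

/-- The convolution `ρ ⋆ g` of real functions. -/
def mollify (ρ g : Rn n → ℝ) : Rn n → ℝ :=
  convolution ρ g (ContinuousLinearMap.lsmul ℝ ℝ) volume

theorem mollify_apply (ρ g : Rn n → ℝ) (x : Rn n) : mollify ρ g x = ∫ y, ρ (x - y) * g y :=
  convolution_lsmul_swap

theorem contDiff_mollify (hρ : ContDiff ℝ ∞ ρ) (hρc : HasCompactSupport ρ)
    (hg : LocallyIntegrable g) : ContDiff ℝ ∞ (mollify ρ g) :=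
  hρc.contDiff_convolution_left _ hρ hg

theorem partialFun_mollify (hρ : ContDiff ℝ ∞ ρ) (hρc : HasCompactSupport ρ)
    (hg : LocallyIntegrable g) (i : Fin n) :
    partialFun i (mollify ρ g) = mollify (partialFun i ρ) g := by
  rw [partialFun_eq_fderiv (contDiff_mollify hρ hρc hg), partialFun_eq_fderiv hρ]
  have hρ1 : ContDiff ℝ 1 ρ := hρ.of_le (mod_cast le_top)
  funext x
  rw [mollify, (hρc.hasFDerivAt_convolution_left _ hρ1 hg x).fderiv]
  have hint := (hρc.fderiv ℝ).convolutionExists_left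
    ((ContinuousLinearMap.lsmul ℝ ℝ).precompL (Rn n) : (Rn n →L[ℝ] ℝ) →L[ℝ] ℝ →L[ℝ] Rn n →L[ℝ] ℝ)
    (hρ1.continuous_fderiv one_ne_zero) hg x
  rw [mollify, convolution_def, ContinuousLinearMap.integral_apply hint, convolution_def]
  rfl

theorem abs_mollify_le (hρ : Continuous ρ) (hρc : HasCompactSupport ρ) (hρ0 : ∀ x, 0 ≤ ρ x)
    (hρ1 : ∫ x, ρ x = 1) {C : ℝ} (hg : ∀ᵐ x, |g x| ≤ C) (x : Rn n) : |mollify ρ g x| ≤ C := by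
  rw [mollify_apply]
  have hint : Integrable fun y => ρ (x - y) :=
    (hρ.integrable_of_hasCompactSupport hρc).comp_sub_left x
  calc |∫ y, ρ (x - y) * g y| ≤ ∫ y, ρ (x - y) * C := by
        rw [← Real.norm_eq_abs]
        refine norm_integral_le_of_norm_le (hint.mul_const C) ?_
        filter_upwards [hg] with y hy
        rw [norm_mul, Real.norm_eq_abs, Real.norm_eq_abs, abs_of_nonneg (hρ0 _)]
        exact mul_le_mul_of_nonneg_left hy (hρ0 _)
    _ = C := by
        rw [integral_mul_const, integral_sub_left_eq_self ρ volume x, hρ1, one_mul]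

variable {Ω : Opens (Rn n)}

/-- Pairing a distribution with this `ψ` plays the role of evaluating its mollification at `x`; the
margin `δ` keeps the support inside `Ω`. -/
theorem exists_testFunction (hρ : ContDiff ℝ ∞ ρ) {δ : ℝ}
    (hsupp : tsupport ρ ⊆ Metric.closedBall 0 δ) {x : Rn n}
    (hx : Metric.closedBall x δ ⊆ (Ω : Set (Rn n))) :
    ∃ ψ : 𝓓(Ω, ℝ), ∀ y, ψ y = ρ (x - y) := by
  have hs : tsupport (fun y => ρ (x - y)) ⊆ Metric.closedBall x δ := by
    refine closure_minimal (fun y hy => ?_) Metric.isClosed_closedBall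
    have := hsupp (subset_tsupport _ hy)
    rwa [mem_closedBall_zero_iff, ← dist_eq_norm, dist_comm] at this
  exact ⟨⟨fun y => ρ (x - y), hρ.comp (by fun_prop),
    HasCompactSupport.of_support_subset_isCompact (isCompact_closedBall x δ)
      ((subset_tsupport _).trans hs), hs.trans hx⟩, fun y => rfl⟩

theorem partialDist_apply (T : 𝓓'(Ω, ℝ)) (i : Fin n) (ψ : 𝓓(Ω, ℝ)) :
    partialDist i T ψ = T (-∂_{(EuclideanSpace.single i 1 : Rn n)} ψ) :=
  Distribution.lineDerivOp_apply_apply T ψ _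

theorem testFunction_partial_apply (i : Fin n) (ψ : 𝓓(Ω, ℝ)) (y : Rn n) :
    (∂_{(EuclideanSpace.single i 1 : Rn n)} ψ) y = partialFun i ψ y :=
  TestFunction.lineDerivCLM_apply_of_le (by simp)

theorem partialFun_comp_const_sub (hρ : ContDiff ℝ ∞ ρ) (x : Rn n) (i : Fin n) :
    partialFun i (fun y => ρ (x - y)) = fun y => -partialFun i ρ (x - y) := by
  have hA : ∀ y, HasFDerivAt (fun y : Rn n => x - y) (-ContinuousLinearMap.id ℝ (Rn n)) y :=
    fun y => (hasFDerivAt_id y).const_sub x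
  have hc : ContDiff ℝ ∞ fun y : Rn n => ρ (x - y) := hρ.comp (by fun_prop)
  rw [partialFun_eq_fderiv hρ, partialFun_eq_fderiv hc]
  funext y
  have h := ((hρ.differentiable (by simp) (x - y)).hasFDerivAt.comp y (hA y)).fderiv
  simp only [Function.comp_def] at h
  rw [h]
  simp

/-- Derivatives of a mollified distribution are the mollifications of its derivatives. -/
theorem foldr_partialDist_apply {T : 𝓓'(Ω, ℝ)} {f : Rn n → ℝ} (hT : IsGivenBy T f)
    (hf : LocallyIntegrable ((Ω : Set (Rn n)).indicator f)) (x : Rn n) (L : List (Fin n)) :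
    ∀ (ρ : Rn n → ℝ), ContDiff ℝ ∞ ρ → HasCompactSupport ρ →
      ∀ ψ : 𝓓(Ω, ℝ), (∀ y, ψ y = ρ (x - y)) →
      L.foldr partialDist T ψ =
        L.foldr partialFun (mollify ρ ((Ω : Set (Rn n)).indicator f)) x := by
  -- The kernel stays quantified in the induction, since each transposed derivative replaces `ρ` by
  -- `partialFun i ρ`.
  induction L with
  | nil =>
    intro ρ hρ hρc ψ hψ
    rw [List.foldr_nil, List.foldr_nil, hT.2 ψ, mollify_apply,
      ← integral_indicator Ω.isOpen.measurableSet]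
    congr 1
    funext y
    by_cases hy : y ∈ (Ω : Set (Rn n))
    · simp only [Set.indicator_of_mem hy, hψ, mul_comm]
    · simp only [Set.indicator_of_notMem hy, mul_zero]
  | cons i L ih =>
    intro ρ hρ hρc ψ hψ
    -- The sign from transposition cancels the sign from the reflection `y ↦ x - y`.
    have hψ' : ∀ y, (-∂_{(EuclideanSpace.single i 1 : Rn n)} ψ) y = partialFun i ρ (x - y) := by
      intro y
      have h1 : (⇑ψ : Rn n → ℝ) = fun y => ρ (x - y) := funext hψ
      change -((∂_{(EuclideanSpace.single i 1 : Rn n)} ψ) y) = _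
      rw [testFunction_partial_apply, h1, partialFun_comp_const_sub hρ, neg_neg]
    have hc : HasCompactSupport (partialFun i ρ) :=
      hρc.of_isClosed_subset (isClosed_tsupport _) (tsupport_partialFun_subset i)
    rw [List.foldr_cons, partialDist_apply, ih _ (contDiff_partialFun hρ i) hc _ hψ',
      ← partialFun_mollify hρ hρc hf, foldr_partialFun_comm (contDiff_mollify hρ hρc hf),
      List.foldr_cons]

theorem multiDeriv_partialDist_apply {T : 𝓓'(Ω, ℝ)} {f : Rn n → ℝ} (hT : IsGivenBy T f)
    (hf : LocallyIntegrable ((Ω : Set (Rn n)).indicator f)) (hρ : ContDiff ℝ ∞ ρ)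
    (hρc : HasCompactSupport ρ) {x : Rn n} {ψ : 𝓓(Ω, ℝ)} (hψ : ∀ y, ψ y = ρ (x - y))
    (α : Fin n →₀ ℕ) :
    multiDeriv partialDist α T ψ =
      multiDeriv partialFun α (mollify ρ ((Ω : Set (Rn n)).indicator f)) x := by
  rw [multiDeriv_eq_foldr, multiDeriv_eq_foldr]
  exact foldr_partialDist_apply hT hf x _ ρ hρ hρc ψ hψ

theorem polyOp_partialDist_apply (p : MvPolynomial (Fin n) ℝ) (T : 𝓓'(Ω, ℝ)) (ψ : 𝓓(Ω, ℝ)) :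
    polyOp partialDist p T ψ = ∑ α ∈ p.support, p.coeff α * multiDeriv partialDist α T ψ := by
  simp [polyOp]

theorem applyDist_apply {k k' : ℕ} (S : Matrix (Fin k) (Fin k') (MvPolynomial (Fin n) ℝ))
    (U : Fin k' → 𝓓'(Ω, ℝ)) (i : Fin k) (ψ : 𝓓(Ω, ℝ)) :
    applyDist S U i ψ = ∑ l, polyOp partialDist (S i l) (U l) ψ := by
  simp [applyDist, matrixOp]

theorem multiDeriv_partialDist_sub (α : Fin n →₀ ℕ) (T T' : 𝓓'(Ω, ℝ)) :
    multiDeriv partialDist α (T - T') = multiDeriv partialDist α T - multiDeriv partialDist α T' := by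
  simp only [multiDeriv_eq_foldr]
  induction multiList α with
  | nil => rfl
  | cons i L ih =>
    rw [List.foldr_cons, ih, List.foldr_cons, List.foldr_cons]
    exact map_sub (Distribution.lineDerivCLM _) _ _

theorem applyDist_sub {k k' : ℕ} (S : Matrix (Fin k) (Fin k') (MvPolynomial (Fin n) ℝ))
    (U V : Fin k' → 𝓓'(Ω, ℝ)) : applyDist S (U - V) = applyDist S U - applyDist S V := by
  funext i
  simp only [applyDist, matrixOp, polyOp, Pi.sub_apply, multiDeriv_partialDist_sub, smul_sub,
    Finset.sum_sub_distrib]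

end Mollification

/-! ### Compactly supported test fields with prescribed image -/

/-- Take a linear section of `A` over its range and extend it to the whole space. -/
theorem exists_generalizedInverse {k k' : ℕ} (A : Matrix (Fin k) (Fin k') ℝ) :
    ∃ B : Matrix (Fin k') (Fin k) ℝ, A * B * A = A := by
  obtain ⟨g, hg⟩ := A.toLin'.rangeRestrict.exists_rightInverse_of_surjective
    A.toLin'.range_rangeRestrict
  obtain ⟨b, hb⟩ := g.exists_extend
  refine ⟨LinearMap.toMatrix' b, Matrix.toLin'.injective ?_⟩
  rw [Matrix.toLin'_mul, Matrix.toLin'_mul, Matrix.toLin'_toMatrix']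
  refine LinearMap.ext fun v => ?_
  have h1 : b (A.toLin' v) = g (A.toLin'.rangeRestrict v) := by
    rw [← hb]
    rfl
  have h2 := LinearMap.congr_fun hg (A.toLin'.rangeRestrict v)
  simp only [LinearMap.comp_apply] at h2 ⊢
  rw [h1]
  exact congrArg Subtype.val h2

section TestField

variable {n k k' : ℕ} {Ω : Opens (Rn n)}

theorem integrable_indicator_of_bound (hΩ : Bornology.IsBounded (Ω : Set (Rn n)))
    {f : Rn n → ℝ} (hf : AEStronglyMeasurable f (volume.restrict (Ω : Set (Rn n)))) {C : ℝ}
    (hC : ∀ᵐ x ∂volume.restrict (Ω : Set (Rn n)), |f x| ≤ C) :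
    Integrable ((Ω : Set (Rn n)).indicator f) := by
  rw [integrable_indicator_iff Ω.isOpen.measurableSet]
  have : IsFiniteMeasure (volume.restrict (Ω : Set (Rn n))) :=
    ⟨by rw [Measure.restrict_apply_univ]; exact hΩ.measure_lt_top⟩
  exact Integrable.of_bound hf C hC

theorem IsGivenBy.aestronglyMeasurable {T : 𝓓'(Ω, ℝ)} {f : Rn n → ℝ} (hT : IsGivenBy T f) :
    AEStronglyMeasurable f (volume.restrict (Ω : Set (Rn n))) :=
  hT.1.aestronglyMeasurable

theorem IsGivenBy.apply_eq_mollify {T : 𝓓'(Ω, ℝ)} {f ρ : Rn n → ℝ} (hT : IsGivenBy T f)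
    (hf : LocallyIntegrable ((Ω : Set (Rn n)).indicator f)) (hρ : ContDiff ℝ ∞ ρ)
    (hρc : HasCompactSupport ρ) {x : Rn n} {ψ : 𝓓(Ω, ℝ)} (hψ : ∀ y, ψ y = ρ (x - y)) :
    T ψ = mollify ρ ((Ω : Set (Rn n)).indicator f) x :=
  foldr_partialDist_apply hT hf x [] ρ hρ hρc ψ hψ

theorem ae_abs_indicator_le {f : Rn n → ℝ} {C : ℝ} (hC0 : 0 ≤ C)
    (hC : ∀ᵐ x ∂volume.restrict (Ω : Set (Rn n)), |f x| ≤ C) :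
    ∀ᵐ x, |(Ω : Set (Rn n)).indicator f x| ≤ C := by
  filter_upwards [(ae_restrict_iff' Ω.isOpen.measurableSet).1 hC] with x hx
  by_cases hxΩ : x ∈ (Ω : Set (Rn n))
  · rw [Set.indicator_of_mem hxΩ]
    exact hx hxΩ
  · rw [Set.indicator_of_notMem hxΩ, abs_zero]
    exact hC0

/-- If `S w = d` on `Ω` and the derivatives of `w l` of order less than `h l` are bounded by `ε`,
then, up to an error of order `ε`, the cut-off mollification of `d` is the image under `S` of a
test field. -/
theorem exists_testField {S : Matrix (Fin k) (Fin k') (MvPolynomial (Fin n) ℝ)} {h : Fin k' → ℕ}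
    (hS : ∀ i l, (S i l).IsHomogeneous (h l)) (hΩ : Bornology.IsBounded (Ω : Set (Rn n)))
    {φ : Rn n → ℝ} (hφ : ContDiff ℝ ∞ φ) (hφc : HasCompactSupport φ) :
    ∃ C, 0 ≤ C ∧ ∀ (w : Fin k' → 𝓓'(Ω, ℝ)) (d : Rn n → Fin k → ℝ) (M ε δ : ℝ) (ρ : Rn n → ℝ),
      (∀ i, IsGivenBy (applyDist S w i) fun x => d x i) →
      (∀ᵐ x ∂volume.restrict (Ω : Set (Rn n)), ∀ i, |d x i| ≤ M) → 0 ≤ ε →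
      (∀ l (β : Fin n →₀ ℕ), β.degree < h l → ∃ f, IsGivenBy (multiDeriv partialDist β (w l)) f ∧
        ∀ᵐ x ∂volume.restrict (Ω : Set (Rn n)), |f x| ≤ ε) →
      Metric.cthickening δ (tsupport φ) ⊆ (Ω : Set (Rn n)) →
      ContDiff ℝ ∞ ρ → (∀ x, 0 ≤ ρ x) → ∫ x, ρ x = 1 → tsupport ρ ⊆ Metric.closedBall 0 δ →
      ∃ q : Fin k' → Rn n → ℝ, (∀ l, ContDiff ℝ ∞ (q l)) ∧ (∀ l, tsupport (q l) ⊆ tsupport φ) ∧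
        ∀ x i, |applyFun S q x i -
          φ x * mollify ρ ((Ω : Set (Rn n)).indicator fun y => d y i) x| ≤ C * ε := by
  choose Cp hCp hbound using fun i l => exists_polyOp_mul_bound (hS i l) hφ hφc
  -- The order-zero part of `S`; columns of positive order are set to zero.
  let A : Matrix (Fin k) (Fin k') ℝ := fun i l => if h l = 0 then (S i l).coeff 0 else 0
  obtain ⟨B, hB⟩ := exists_generalizedInverse A
  let N : Matrix (Fin k) (Fin k) ℝ := 1 - A * B
  let C : ℝ := ∑ i, ∑ j, |N i j| * ∑ l, Cp j l
  have hCi0 : ∀ i j, 0 ≤ |N i j| * ∑ l, Cp j l := fun i j =>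
    mul_nonneg (abs_nonneg _) (Finset.sum_nonneg fun l _ => hCp j l)
  have hC0 : 0 ≤ C := Finset.sum_nonneg fun i _ => Finset.sum_nonneg fun j _ => hCi0 i j
  refine ⟨C, hC0, fun w d M ε δ ρ hwd hdM hε hlow hδ hρ hρ0 hρ1 hρs => ?_⟩
  have hρc : HasCompactSupport ρ :=
    HasCompactSupport.of_support_subset_isCompact (isCompact_closedBall 0 δ)
      ((subset_tsupport _).trans hρs)
  choose! f hf hfε using hlow
  have hfint : ∀ l (β : Fin n →₀ ℕ), β.degree < h l →
      LocallyIntegrable ((Ω : Set (Rn n)).indicator (f l β)) := fun l β hβ =>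
    (integrable_indicator_of_bound hΩ (hf l β hβ).aestronglyMeasurable (hfε l β hβ)).locallyIntegrable
  have hdint : ∀ i, LocallyIntegrable ((Ω : Set (Rn n)).indicator fun x => d x i) := fun i =>
    (integrable_indicator_of_bound hΩ (hwd i).aestronglyMeasurable
      (hdM.mono fun x hx => hx i)).locallyIntegrable
  -- Only components with `h l > 0` are known to be functions (take `β = 0` in the bounds), so only
  -- these are mollified.
  let W : Fin k' → Rn n → ℝ := fun l =>
    if h l = 0 then 0 else mollify ρ ((Ω : Set (Rn n)).indicator (f l 0))
  have hW : ∀ l, ContDiff ℝ ∞ (W l) := by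
    intro l
    by_cases hl : h l = 0
    · simp only [W, if_pos hl]
      exact contDiff_const (c := (0 : ℝ))
    · simp only [W, if_neg hl]
      exact contDiff_mollify hρ hρc (hfint l 0 (by simpa using Nat.pos_of_ne_zero hl))
  let D : Fin k → Rn n → ℝ := fun i => mollify ρ ((Ω : Set (Rn n)).indicator fun y => d y i)
  have hD : ∀ i, ContDiff ℝ ∞ (D i) := fun i => contDiff_mollify hρ hρc (hdint i)
  let E : Fin k → Rn n → ℝ := fun i x => ∑ l, polyOp partialFun (S i l) (φ * W l) x
  have hφW : ∀ l, ContDiff ℝ ∞ (φ * W l) := fun l => hφ.mul (hW l)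
  have hE : ∀ i, ContDiff ℝ ∞ (E i) := fun i =>
    ContDiff.sum fun l _ => contDiff_polyOp (hφW l) (S i l)
  have hφWs : ∀ l, tsupport (φ * W l) ⊆ tsupport φ := fun l => tsupport_mul_subset_left
  have hE0 : ∀ i x, x ∉ tsupport φ → E i x = 0 := fun i x hx =>
    Finset.sum_eq_zero fun l _ => polyOp_eq_zero_of_notMem_tsupport (fun hx' => hx (hφWs l hx')) _
  -- The positive-order components of the test field already contribute `E`. The order-zero ones are
  -- chosen to produce, via `B`, as much as possible of the remainder `φ D - E`.
  let e : Fin k' → Rn n → ℝ := fun l x => ∑ i, B l i * (φ x * D i x - E i x)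
  have he : ∀ l, ContDiff ℝ ∞ (e l) := fun l =>
    ContDiff.sum fun i _ => contDiff_const.mul ((hφ.mul (hD i)).sub (hE i))
  have hes : ∀ l, tsupport (e l) ⊆ tsupport φ := by
    intro l
    refine closure_minimal (fun x hx => ?_) (isClosed_tsupport φ)
    by_contra hxφ
    refine hx (Finset.sum_eq_zero fun i _ => ?_)
    rw [hE0 i x hxφ, image_eq_zero_of_notMem_tsupport hxφ]
    simp
  let q : Fin k' → Rn n → ℝ := fun l => if h l = 0 then e l else φ * W l
  have hqs : ∀ l, tsupport (q l) ⊆ tsupport φ := by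
    intro l
    by_cases hl : h l = 0
    · simp only [q, if_pos hl]
      exact hes l
    · simp only [q, if_neg hl]
      exact hφWs l
  refine ⟨q, fun l => ?_, hqs, fun x i => ?_⟩
  · by_cases hl : h l = 0
    · simp only [q, if_pos hl]
      exact he l
    · simp only [q, if_neg hl]
      exact hφW l
  by_cases hx : x ∈ tsupport φ
  swap
  · rw [applyFun_apply, Finset.sum_eq_zero fun l _ =>
      polyOp_eq_zero_of_notMem_tsupport (fun hx' => hx (hqs l hx')) _,
      image_eq_zero_of_notMem_tsupport hx]
    simpa using mul_nonneg hC0 hε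
  obtain ⟨ψ, hψ⟩ := exists_testFunction (Ω := Ω) hρ hρs (x := x)
    ((Metric.closedBall_subset_cthickening hx δ).trans hδ)
  have hterm : ∀ l, h l ≠ 0 → ∀ α, multiDeriv partialDist α (w l) ψ =
      multiDeriv partialFun α (W l) x := by
    intro l hl α
    have hpos : (0 : Fin n →₀ ℕ).degree < h l := by simpa using Nat.pos_of_ne_zero hl
    have h0 := hf l 0 hpos
    rw [multiDeriv_zero] at h0
    simp only [W, if_neg hl]
    exact multiDeriv_partialDist_apply h0 (hfint l 0 hpos) hρ hρc hψ α
  have hsmall : ∀ l (β : Fin n →₀ ℕ), β.degree < h l →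
      |multiDeriv partialFun β (W l) x| ≤ ε := by
    intro l β hβ
    rw [← hterm l (by omega) β, (hf l β hβ).apply_eq_mollify (hfint l β hβ) hρ hρc hψ]
    exact abs_mollify_le hρ.continuous hρc hρ0 hρ1 (ae_abs_indicator_le hε (hfε l β hβ)) x
  let P : Fin k → ℝ := fun i => ∑ l, polyOp partialFun (S i l) (W l) x
  let a : Fin k' → ℝ := fun l => w l ψ
  have hpoly0 : ∀ i l, h l = 0 → ∀ (g : Rn n → ℝ),
      polyOp partialFun (S i l) g = (S i l).coeff 0 • g := fun i l hl g =>
    polyOp_of_isHomogeneous_zero (hl ▸ hS i l) _ g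
  have hDP : (fun i => D i x) = P + A.mulVec a := by
    funext i
    have h1 : D i x = applyDist S w i ψ :=
      ((hwd i).apply_eq_mollify (hdint i) hρ hρc hψ).symm
    rw [h1, applyDist_apply, Pi.add_apply, Matrix.mulVec, dotProduct, ← Finset.sum_add_distrib]
    refine Finset.sum_congr rfl fun l _ => ?_
    by_cases hl : h l = 0
    · rw [polyOp_of_isHomogeneous_zero (hl ▸ hS i l), hpoly0 i l hl]
      simp only [W, A, a, if_pos hl]
      simp
    · rw [polyOp_partialDist_apply, polyOp_apply]
      simp only [A, if_neg hl, zero_mul, add_zero, hterm l hl]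
  have hSq : (fun i => applyFun S q x i) =
      (fun i => E i x) + A.mulVec (B.mulVec (φ x • (fun i => D i x) - fun i => E i x)) := by
    funext i
    rw [applyFun_apply, Pi.add_apply, Matrix.mulVec, dotProduct, ← Finset.sum_add_distrib]
    refine Finset.sum_congr rfl fun l _ => ?_
    by_cases hl : h l = 0
    · rw [hpoly0 i l hl, hpoly0 i l hl]
      simp only [W, A, q, if_pos hl]
      simp [e, Matrix.mulVec, dotProduct]
    · simp only [A, q, if_neg hl, zero_mul, add_zero]
  -- With `D = P + A a`, the identity `A B A = A` makes the uncontrolled vector `a` drop out. What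
  -- is left is `1 - A B` applied to the commutator `E - φ P`.
  have hdiff : (fun i => applyFun S q x i) - φ x • (fun i => D i x) =
      N.mulVec ((fun i => E i x) - φ x • P) := by
    simp only [N]
    rw [hSq, hDP]
    have hABA : A.mulVec (B.mulVec (A.mulVec a)) = A.mulVec a := by
      rw [Matrix.mulVec_mulVec, Matrix.mulVec_mulVec, hB]
    simp only [Matrix.mulVec_sub, Matrix.mulVec_add, Matrix.mulVec_smul, Matrix.sub_mulVec,
      Matrix.one_mulVec, smul_add, smul_sub, hABA, ← Matrix.mulVec_mulVec]
    abel
  have hdi := congrFun hdiff i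
  simp only [Pi.sub_apply, Pi.smul_apply, smul_eq_mul] at hdi
  change |applyFun S q x i - φ x * D i x| ≤ C * ε
  rw [hdi, Matrix.mulVec, dotProduct]
  have hr : ∀ j, |E j x - φ x * P j| ≤ (∑ l, Cp j l) * ε := by
    intro j
    simp only [E, P]
    rw [Finset.mul_sum, ← Finset.sum_sub_distrib, Finset.sum_mul]
    exact (Finset.abs_sum_le_sum_abs _ _).trans
      (Finset.sum_le_sum fun l _ => hbound j l (W l) (hW l) x ε hε (hsmall l))
  calc |∑ j, N i j * ((fun i => E i x) - φ x • P) j|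
      ≤ ∑ j, |N i j| * ((∑ l, Cp j l) * ε) := by
        refine (Finset.abs_sum_le_sum_abs _ _).trans (Finset.sum_le_sum fun j _ => ?_)
        rw [abs_mul]
        exact mul_le_mul_of_nonneg_left (hr j) (abs_nonneg _)
    _ = (∑ j, |N i j| * ∑ l, Cp j l) * ε := by
        rw [Finset.sum_mul]
        exact Finset.sum_congr rfl fun j _ => by ring
    _ ≤ C * ε := mul_le_mul_of_nonneg_right
        (Finset.single_le_sum (f := fun i => ∑ j, |N i j| * ∑ l, Cp j l)
          (fun i _ => Finset.sum_nonneg fun j _ => hCi0 i j) (Finset.mem_univ i)) hε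

end TestField

/-! ### Lower semicontinuity along perturbations of constants -/

section ConstantLimit

variable {n k k' : ℕ} {Ω : Opens (Rn n)}

theorem integrable_comp_of_bound {X : Type*} [MeasurableSpace X] {μ : Measure X}
    [IsFiniteMeasure μ] {F : (Fin k → ℝ) → ℝ} (hF : Continuous F) {g : X → Fin k → ℝ}
    (hg : AEStronglyMeasurable g μ) {R : ℝ} (hR : ∀ᵐ x ∂μ, ‖g x‖ ≤ R) :
    Integrable (fun x => F (g x)) μ := by
  obtain ⟨K, hK⟩ := (isCompact_closedBall (0 : Fin k → ℝ) R).exists_bound_of_continuousOn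
    hF.continuousOn
  refine Integrable.of_bound (hF.comp_aestronglyMeasurable hg) K ?_
  filter_upwards [hR] with x hx
  exact hK _ (mem_closedBall_zero_iff.2 hx)

theorem isFiniteMeasure_restrict (hΩ : Bornology.IsBounded (Ω : Set (Rn n))) :
    IsFiniteMeasure (volume.restrict (Ω : Set (Rn n))) :=
  ⟨by rw [Measure.restrict_apply_univ]; exact hΩ.measure_lt_top⟩

theorem exists_mollifiers {δ : ℝ} (hδ : 0 < δ) :
    ∃ ρ : ℕ → Rn n → ℝ, (∀ m, ContDiff ℝ ∞ (ρ m)) ∧ (∀ m x, 0 ≤ ρ m x) ∧ (∀ m, ∫ x, ρ m x = 1) ∧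
      (∀ m, tsupport (ρ m) ⊆ Metric.closedBall 0 δ) ∧
      ∀ g : Rn n → ℝ, LocallyIntegrable g →
        ∀ᵐ x, Tendsto (fun m => mollify (ρ m) g x) atTop (𝓝 (g x)) := by
  have hpos : ∀ m : ℕ, 0 < δ / (m + 1) := fun m => by positivity
  -- Inner and outer radii in fixed ratio `2`: a bounded ratio gives almost everywhere convergence
  -- for merely locally integrable `g`.
  let b : ℕ → ContDiffBump (0 : Rn n) := fun m =>
    ⟨δ / (m + 1) / 2, δ / (m + 1), half_pos (hpos m), half_lt_self (hpos m)⟩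
  refine ⟨fun m => (b m).normed volume, fun m => (b m).contDiff_normed,
    fun m => (b m).nonneg_normed, fun m => (b m).integral_normed, fun m => ?_, fun g hg => ?_⟩
  · rw [(b m).tsupport_normed_eq]
    refine Metric.closedBall_subset_closedBall ?_
    exact div_le_self hδ.le (by norm_cast; omega)
  · refine ContDiffBump.ae_convolution_tendsto_right_of_locallyIntegrable (φ := b) (K := 2) ?_ ?_ hg
    · exact tendsto_const_div_atTop_nhds_zero_nat δ |>.comp (tendsto_add_atTop_nat 1) |>.congr
        fun m => by simp [b]
    · exact Eventually.of_forall fun m => by simp only [b]; linarith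

theorem continuous_applyFun (S : Matrix (Fin k) (Fin k') (MvPolynomial (Fin n) ℝ))
    {q : Fin k' → Rn n → ℝ} (hq : ∀ l, ContDiff ℝ ∞ (q l)) : Continuous (applyFun S q) := by
  refine continuous_pi fun i => ?_
  simp only [applyFun_apply]
  exact continuous_finsetSum _ fun l _ => (contDiff_polyOp (hq l) (S i l)).continuous

/-- The quasiconvexity inequality for the cut-off `φ d` of an image `d = S w`, up to an error
controlled by the derivatives of `w l` of order less than `h l`. -/
theorem Quasiconvex.integral_cutoff_ge
    {S : Matrix (Fin k) (Fin k') (MvPolynomial (Fin n) ℝ)} {h : Fin k' → ℕ}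
    (hS : ∀ i l, (S i l).IsHomogeneous (h l)) (hΩ : Bornology.IsBounded (Ω : Set (Rn n)))
    {F : (Fin k → ℝ) → ℝ} (hF : Continuous F) (hqc : Quasiconvex S F)
    {φ : Rn n → ℝ} (hφ : ContDiff ℝ ∞ φ) (hφc : HasCompactSupport φ)
    (hφΩ : tsupport φ ⊆ (Ω : Set (Rn n))) (hφ1 : ∀ x, φ x ∈ Set.Icc (0 : ℝ) 1) :
    ∃ C, 0 ≤ C ∧ ∀ (w : Fin k' → 𝓓'(Ω, ℝ)) (d : Rn n → Fin k → ℝ) (M ε η R : ℝ) (z : Fin k → ℝ),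
      (∀ i, IsGivenBy (applyDist S w i) fun x => d x i) → 0 ≤ M →
      (∀ᵐ x ∂volume.restrict (Ω : Set (Rn n)), ‖d x‖ ≤ M) → 0 ≤ ε →
      (∀ l (β : Fin n →₀ ℕ), β.degree < h l → ∃ f, IsGivenBy (multiDeriv partialDist β (w l)) f ∧
        ∀ᵐ x ∂volume.restrict (Ω : Set (Rn n)), |f x| ≤ ε) →
      ‖z‖ + M + C * ε ≤ R →
      (∀ a b : Fin k → ℝ, ‖a‖ ≤ R → ‖b‖ ≤ R → dist a b ≤ C * ε → |F a - F b| ≤ η) →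
      -(η * volume.real (Ω : Set (Rn n))) ≤
        ∫ x in (Ω : Set (Rn n)), (F (z + φ x • d x) - F z) := by
  obtain ⟨C, hC, htest⟩ := exists_testField hS hΩ hφ hφc
  refine ⟨C, hC, fun w d M ε η R z hwd hM0 hdM hε hlow hR hFη => ?_⟩
  have hfin := isFiniteMeasure_restrict hΩ
  obtain ⟨δ, hδ, hδΩ⟩ := hφc.isCompact.exists_cthickening_subset_open Ω.isOpen hφΩ
  obtain ⟨ρ, hρ, hρ0, hρ1, hρs, hρt⟩ := exists_mollifiers (n := n) hδ
  have hdM' : ∀ᵐ x ∂volume.restrict (Ω : Set (Rn n)), ∀ i, |d x i| ≤ M :=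
    hdM.mono fun x hx i => (norm_le_pi_norm (d x) i).trans hx
  have hdint : ∀ i, LocallyIntegrable ((Ω : Set (Rn n)).indicator fun x => d x i) := fun i =>
    (integrable_indicator_of_bound hΩ (hwd i).aestronglyMeasurable
      (hdM'.mono fun x hx => hx i)).locallyIntegrable
  let D : ℕ → Rn n → Fin k → ℝ := fun m x i =>
    mollify (ρ m) ((Ω : Set (Rn n)).indicator fun y => d y i) x
  have hρc : ∀ m, HasCompactSupport (ρ m) := fun m =>
    HasCompactSupport.of_support_subset_isCompact (isCompact_closedBall 0 δ)
      ((subset_tsupport _).trans (hρs m))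
  have hDM : ∀ m x, ‖D m x‖ ≤ M := fun m x =>
    (pi_norm_le_iff_of_nonneg hM0).2 fun i => abs_mollify_le (hρ m).continuous (hρc m) (hρ0 m)
      (hρ1 m) (ae_abs_indicator_le hM0 (hdM'.mono fun x hx => hx i)) x
  have hDcont : ∀ m, Continuous (D m) := fun m =>
    continuous_pi fun i => (contDiff_mollify (hρ m) (hρc m) (hdint i)).continuous
  have hφD : ∀ m x, ‖z + φ x • D m x‖ ≤ ‖z‖ + M := by
    intro m x
    refine (norm_add_le _ _).trans (add_le_add le_rfl ?_)
    rw [norm_smul, Real.norm_eq_abs, abs_of_nonneg (hφ1 x).1]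
    exact (mul_le_of_le_one_left (norm_nonneg _) (hφ1 x).2).trans (hDM m x)
  have hCε : 0 ≤ C * ε := mul_nonneg hC hε
  have hφDcont : ∀ m, Continuous fun x => z + φ x • D m x := fun m =>
    continuous_const.add (hφ.continuous.smul (hDcont m))
  -- The constant `C` does not depend on the mollifier, so this bound is uniform in `m` and survives
  -- the dominated limit `D m → d`.
  have hstep : ∀ m, -(η * volume.real (Ω : Set (Rn n))) ≤
      ∫ x in (Ω : Set (Rn n)), (F (z + φ x • D m x) - F z) := by
    intro m
    obtain ⟨q, hq, hqs, hqD⟩ := htest w d M ε δ (ρ m) hwd hdM' hε hlow hδΩ (hρ m) (hρ0 m) (hρ1 m)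
      (hρs m)
    have hqc' : ∀ l, HasCompactSupport (q l) := fun l =>
      hφc.of_isClosed_subset (isClosed_tsupport _) (hqs l)
    have h0 := hqc.integral_nonneg hS z q hq hqc'
    rw [← setIntegral_eq_integral_of_forall_compl_eq_zero (s := (Ω : Set (Rn n)))] at h0
    swap
    · intro x hx
      have : applyFun S q x = 0 := by
        funext i
        rw [applyFun_apply]
        exact Finset.sum_eq_zero fun l _ =>
          polyOp_eq_zero_of_notMem_tsupport (fun hx' => hx (hφΩ (hqs l hx'))) _
      rw [this, add_zero, sub_self]
    have hdist : ∀ x, dist (z + applyFun S q x) (z + φ x • D m x) ≤ C * ε := by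
      intro x
      rw [dist_add_left, dist_pi_le_iff hCε]
      intro i
      rw [Real.dist_eq]
      exact hqD x i
    have hqR : ∀ x, ‖z + applyFun S q x‖ ≤ R := by
      intro x
      have h1 := norm_le_norm_add_norm_sub (z + φ x • D m x) (z + applyFun S q x)
      rw [← dist_eq_norm, dist_comm] at h1
      linarith [hφD m x, hdist x]
    have hi1 : Integrable (fun x => F (z + applyFun S q x) - F z)
        (volume.restrict (Ω : Set (Rn n))) :=
      (integrable_comp_of_bound hF
        (continuous_const.add (continuous_applyFun S hq)).aestronglyMeasurable
        (Eventually.of_forall hqR)).sub (integrable_const _)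
    have hi2 : Integrable (fun x => F (z + φ x • D m x) - F z)
        (volume.restrict (Ω : Set (Rn n))) :=
      (integrable_comp_of_bound hF (hφDcont m).aestronglyMeasurable
        (Eventually.of_forall (hφD m))).sub (integrable_const _)
    have h2 : ∫ x in (Ω : Set (Rn n)), (F (z + applyFun S q x) - F z) ≤
        ∫ x in (Ω : Set (Rn n)), ((F (z + φ x • D m x) - F z) + η) := by
      refine integral_mono hi1 (hi2.add (integrable_const η)) fun x => ?_
      have h3 := hFη _ _ (hqR x) ((hφD m x).trans (by linarith)) (hdist x)
      have h4 := le_abs_self (F (z + applyFun S q x) - F (z + φ x • D m x))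
      dsimp only
      linarith
    rw [integral_add hi2 (integrable_const η), integral_const, smul_eq_mul,
      measureReal_restrict_apply_univ] at h2
    linarith
  obtain ⟨K, hK⟩ := (isCompact_closedBall (0 : Fin k → ℝ) (‖z‖ + M)).exists_bound_of_continuousOn
    hF.continuousOn
  refine ge_of_tendsto' (tendsto_integral_of_dominated_convergence (fun _ => K + |F z|)
    (fun m => ((hF.comp (hφDcont m)).sub continuous_const).aestronglyMeasurable)
    (integrable_const _) (fun m => Eventually.of_forall fun x => ?_) ?_) hstep
  · exact (norm_sub_le _ _).trans
      (add_le_add (hK _ (mem_closedBall_zero_iff.2 (hφD m x))) le_rfl)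
  · have hall : ∀ᵐ x, ∀ i, Tendsto (fun m => D m x i) atTop
        (𝓝 ((Ω : Set (Rn n)).indicator (fun y => d y i) x)) :=
      ae_all_iff.2 fun i => hρt _ (hdint i)
    filter_upwards [ae_restrict_of_ae hall, ae_restrict_mem Ω.isOpen.measurableSet] with x hx hxΩ
    have hlim : Tendsto (fun m => D m x) atTop (𝓝 (d x)) := by
      refine tendsto_pi_nhds.2 fun i => ?_
      have := hx i
      rwa [Set.indicator_of_mem hxΩ] at this
    exact ((hF.tendsto _).comp ((hlim.const_smul (φ x)).const_add z)).sub_const _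

theorem exists_cutoff {K V : Set (Rn n)} (hK : IsCompact K) (hV : IsOpen V) (hKV : K ⊆ V) :
    ∃ φ : Rn n → ℝ, ContDiff ℝ ∞ φ ∧ HasCompactSupport φ ∧ tsupport φ ⊆ V ∧
      (∀ x ∈ K, φ x = 1) ∧ ∀ x, φ x ∈ Set.Icc (0 : ℝ) 1 := by
  obtain ⟨L, hL, hKL, hLV⟩ := exists_compact_between hK hV hKV
  obtain ⟨f, hf0, hf1, hf⟩ := exists_contMDiffMap_zero_one_of_isClosed
    (modelWithCornersSelf ℝ (Rn n)) (n := ⊤) (isOpen_interior (s := L)).isClosed_compl hK.isClosed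
    (Set.disjoint_compl_left_iff_subset.2 hKL)
  have hsupp : Function.support f ⊆ L := by
    intro x hx
    by_contra hxL
    exact hx (hf0 fun hxi => hxL (interior_subset hxi))
  have htsupp : tsupport f ⊆ L := closure_minimal hsupp hL.isClosed
  exact ⟨f, contMDiff_iff_contDiff.1 f.contMDiff,
    HasCompactSupport.of_support_subset_isCompact hL hsupp, htsupp.trans hLV, fun x hx => hf1 hx, hf⟩

/-- If `d j = S (w j)` is bounded and the derivatives of `w j l` of order less than `h l` tend
uniformly to `0`, then `liminf ∫_A F(z + d j) ≥ ∫_A F(z)` for each constant `z`. -/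
theorem Quasiconvex.eventually_setIntegral_ge
    {S : Matrix (Fin k) (Fin k') (MvPolynomial (Fin n) ℝ)} {h : Fin k' → ℕ}
    (hS : ∀ i l, (S i l).IsHomogeneous (h l)) (hΩ : Bornology.IsBounded (Ω : Set (Rn n)))
    {F : (Fin k → ℝ) → ℝ} (hF : Continuous F) (hqc : Quasiconvex S F)
    {w : ℕ → Fin k' → 𝓓'(Ω, ℝ)} {d : ℕ → Rn n → Fin k → ℝ} {M : ℝ} (hM0 : 0 ≤ M)
    (hwd : ∀ j i, IsGivenBy (applyDist S (w j) i) fun x => d j x i)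
    (hdm : ∀ j, AEStronglyMeasurable (d j) (volume.restrict (Ω : Set (Rn n))))
    (hdM : ∀ j, ∀ᵐ x ∂volume.restrict (Ω : Set (Rn n)), ‖d j x‖ ≤ M)
    (hlow : ∀ ε > 0, ∀ᶠ j in atTop, ∀ l (β : Fin n →₀ ℕ), β.degree < h l →
      ∃ f, IsGivenBy (multiDeriv partialDist β (w j l)) f ∧
        ∀ᵐ x ∂volume.restrict (Ω : Set (Rn n)), |f x| ≤ ε)
    {A : Set (Rn n)} (hA : MeasurableSet A) (hAΩ : A ⊆ (Ω : Set (Rn n))) (z : Fin k → ℝ)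
    {κ : ℝ} (hκ : 0 < κ) :
    ∀ᶠ j in atTop, -κ ≤ ∫ x in A, (F (z + d j x) - F z) := by
  have hfin := isFiniteMeasure_restrict hΩ
  have hΩtop : volume (Ω : Set (Rn n)) < ⊤ := hΩ.measure_lt_top
  have hAtop : volume A ≠ ⊤ := ((measure_mono hAΩ).trans_lt hΩtop).ne
  let R : ℝ := ‖z‖ + M + 1
  obtain ⟨K, hK⟩ := (isCompact_closedBall (0 : Fin k → ℝ) R).exists_bound_of_continuousOn
    hF.continuousOn
  have hK0 : 0 ≤ K := (norm_nonneg _).trans (hK 0 (by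
    rw [mem_closedBall_zero_iff, norm_zero]; positivity))
  -- The layer `V \ Q` has measure at most `2 * s` and costs at most `4 * K` per unit measure, hence
  -- at most `κ / 2` in total.
  let s : ℝ := κ / (16 * (K + 1))
  have hs : 0 < s := by positivity
  have hs' : ENNReal.ofReal s ≠ 0 := by simpa using hs
  obtain ⟨Q, hQA, hQ, hQs⟩ := hA.exists_isCompact_sdiff_lt hAtop hs'
  obtain ⟨V', hAV', hV', -, hVs⟩ := hA.exists_isOpen_sdiff_lt hAtop hs'
  let V : Set (Rn n) := V' ∩ Ω
  have hV : IsOpen V := hV'.inter Ω.isOpen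
  have hAV : A ⊆ V := Set.subset_inter hAV' hAΩ
  have hVQ : volume.real (V \ Q) ≤ 2 * s := by
    have h1 : volume (V \ Q) ≤ ENNReal.ofReal (2 * s) := by
      calc volume (V \ Q) ≤ volume ((V' \ A) ∪ (A \ Q)) := measure_mono (by
            rintro x ⟨hxV, hxQ⟩
            by_cases hxA : x ∈ A
            · exact Or.inr ⟨hxA, hxQ⟩
            · exact Or.inl ⟨hxV.1, hxA⟩)
        _ ≤ volume (V' \ A) + volume (A \ Q) := measure_union_le _ _
        _ ≤ ENNReal.ofReal s + ENNReal.ofReal s := add_le_add hVs.le hQs.le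
        _ = ENNReal.ofReal (2 * s) := by rw [← ENNReal.ofReal_add hs.le hs.le, two_mul]
    exact ENNReal.toReal_le_of_le_ofReal (by positivity) h1
  obtain ⟨φ, hφ, hφc, hφV, hφQ, hφ1⟩ := exists_cutoff hQ hV (hQA.trans hAV)
  obtain ⟨C, hC, hcut⟩ := hqc.integral_cutoff_ge hS hΩ hF hφ hφc
    (hφV.trans Set.inter_subset_right) hφ1
  let η : ℝ := κ / (2 * (volume.real (Ω : Set (Rn n)) + 1))
  have hη : 0 < η := by positivity
  obtain ⟨τ, hτ, hFτ⟩ := Metric.uniformContinuousOn_iff.1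
    ((isCompact_closedBall (0 : Fin k → ℝ) R).uniformContinuousOn_of_continuous hF.continuousOn)
    η hη
  -- This makes `C * ε` smaller than both the continuity modulus `τ` and the slack `1` built into
  -- `R`.
  let ε : ℝ := min τ 1 / (2 * (C + 1))
  have hmin : 0 < min τ 1 := lt_min hτ one_pos
  have hε : 0 < ε := by positivity
  have hCε : C * ε < min τ 1 := by
    have h1 : (C + 1) * ε = min τ 1 / 2 := by
      simp only [ε]
      field_simp
    nlinarith
  filter_upwards [hlow ε hε] with j hj
  have hmain := hcut (w j) (d j) M ε η R z (hwd j) hM0 (hdM j) hε.le hj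
    (by simp only [R]; linarith [hCε.trans_le (min_le_right τ 1)])
    (fun a b ha hb hab => by
      have := hFτ a (mem_closedBall_zero_iff.2 ha) b (mem_closedBall_zero_iff.2 hb)
        (hab.trans_lt (hCε.trans_le (min_le_left τ 1)))
      rw [Real.dist_eq] at this
      exact this.le)
  have hb1 : ∀ t ∈ Set.Icc (0 : ℝ) 1, ∀ y : Fin k → ℝ, ‖y‖ ≤ M → ‖z + t • y‖ ≤ R := by
    intro t ht y hy
    have h1 : ‖t • y‖ ≤ M := by
      rw [norm_smul, Real.norm_eq_abs, abs_of_nonneg ht.1]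
      exact (mul_le_of_le_one_left (norm_nonneg _) ht.2).trans hy
    have h2 := norm_add_le z (t • y)
    simp only [R]
    linarith
  have hb2 : ∀ t ∈ Set.Icc (0 : ℝ) 1, ∀ y : Fin k → ℝ, ‖y‖ ≤ M → |F (z + t • y) - F z| ≤ 2 * K := by
    intro t ht y hy
    have h1 := hK _ (mem_closedBall_zero_iff.2 (hb1 t ht y hy))
    have h2 := hK z (mem_closedBall_zero_iff.2 (by simp only [R]; linarith))
    rw [Real.norm_eq_abs] at h1 h2
    exact (abs_sub _ _).trans (by linarith)
  have hi1 : Integrable (fun x => F (z + φ x • d j x) - F z) (volume.restrict (Ω : Set (Rn n))) :=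
    (integrable_comp_of_bound hF
      (aestronglyMeasurable_const.add (hφ.continuous.aestronglyMeasurable.smul (hdm j)))
      ((hdM j).mono fun x hx => hb1 _ (hφ1 x) _ hx)).sub (integrable_const _)
  have hi2 : Integrable (fun x => F (z + d j x) - F z) (volume.restrict (Ω : Set (Rn n))) :=
    (integrable_comp_of_bound hF (aestronglyMeasurable_const.add (hdm j))
      ((hdM j).mono fun x hx => by
        simpa using hb1 1 ⟨zero_le_one, le_rfl⟩ _ hx)).sub (integrable_const _)
  have hVQm : MeasurableSet (V \ Q) := hV.measurableSet.diff hQ.measurableSet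
  -- On `Q` the cut-off is `1` and the integrands agree; off `V` it is `0` and both vanish. On `V \
  -- Q` each is at most `2 * K` in absolute value.
  have hcmp : ∫ x in (Ω : Set (Rn n)), (F (z + φ x • d j x) - F z) ≤
      ∫ x in (Ω : Set (Rn n)), (A.indicator (fun x => F (z + d j x) - F z) x +
        (V \ Q).indicator (fun _ => 4 * K) x) := by
    refine integral_mono_ae hi1
      ((hi2.indicator hA).add ((integrable_const _).indicator hVQm)) ?_
    filter_upwards [hdM j] with x hx
    have h1 := hb2 _ (hφ1 x) _ hx
    have h2 := hb2 1 ⟨zero_le_one, le_rfl⟩ _ hx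
    rw [one_smul] at h2
    rw [abs_le] at h1 h2
    by_cases hxV : x ∈ V
    · by_cases hxQ : x ∈ Q
      · rw [Set.indicator_of_mem (hQA hxQ), Set.indicator_of_notMem fun hx' => hx'.2 hxQ,
          hφQ x hxQ, one_smul, add_zero]
      · have hxVQ : x ∈ V \ Q := ⟨hxV, hxQ⟩
        rw [Set.indicator_of_mem hxVQ]
        by_cases hxA : x ∈ A
        · rw [Set.indicator_of_mem hxA]
          linarith
        · rw [Set.indicator_of_notMem hxA]
          linarith
    · rw [Set.indicator_of_notMem fun hxA => hxV (hAV hxA),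
        Set.indicator_of_notMem fun hx' => hxV hx'.1,
        image_eq_zero_of_notMem_tsupport fun hx' => hxV (hφV hx')]
      simp
  rw [integral_add (hi2.indicator hA) ((integrable_const _).indicator hVQm),
    integral_indicator hA, integral_indicator hVQm, Measure.restrict_restrict hA,
    Measure.restrict_restrict hVQm, Set.inter_eq_left.2 hAΩ,
    Set.inter_eq_left.2 ((Set.sdiff_subset).trans Set.inter_subset_right), setIntegral_const,
    smul_eq_mul] at hcmp
  have h1 : volume.real (V \ Q) * (4 * K) ≤ κ / 2 := by
    calc volume.real (V \ Q) * (4 * K) ≤ 2 * s * (4 * K) :=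
          mul_le_mul_of_nonneg_right hVQ (by positivity)
      _ ≤ 2 * s * (4 * (K + 1)) := by
          refine mul_le_mul_of_nonneg_left (by linarith) (by positivity)
      _ = κ / 2 := by
          simp only [s]
          field_simp
          norm_num
  have h2 : η * volume.real (Ω : Set (Rn n)) ≤ κ / 2 := by
    calc η * volume.real (Ω : Set (Rn n)) ≤ η * (volume.real (Ω : Set (Rn n)) + 1) :=
          mul_le_mul_of_nonneg_left (by linarith) hη.le
      _ = κ / 2 := by
          have : volume.real (Ω : Set (Rn n)) + 1 ≠ 0 := by positivity
          simp only [η]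
          field_simp
  linarith

end ConstantLimit

/-! ### Uniform boundedness and approximation by step functions -/

section Measure

variable {X : Type*} [MeasurableSpace X] {μ : Measure X}

theorem ae_norm_le_of_eLpNorm_top_le {E : Type*} [NormedAddCommGroup E] {f : X → E} {C : ℝ}
    (hC : 0 ≤ C) (hf : eLpNorm f ⊤ μ ≤ ENNReal.ofReal C) : ∀ᵐ x ∂μ, ‖f x‖ ≤ C := by
  rw [eLpNorm_exponent_top] at hf
  filter_upwards [ae_le_eLpNormEssSup (f := f) (μ := μ)] with x hx
  have h := hx.trans hf
  rwa [← ofReal_norm, ENNReal.ofReal_le_ofReal_iff hC] at h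

theorem ae_norm_le_toReal_eLpNorm {E : Type*} [NormedAddCommGroup E] {f : X → E}
    (hf : MemLp f ⊤ μ) : ∀ᵐ x ∂μ, ‖f x‖ ≤ (eLpNorm f ⊤ μ).toReal :=
  ae_norm_le_of_eLpNorm_top_le ENNReal.toReal_nonneg (ENNReal.ofReal_toReal hf.2.ne).ge

/-- The uniform boundedness principle for sequences in `L^∞`. -/
theorem exists_ae_bound_of_forall_integral_mul_bounded [IsFiniteMeasure μ] {f : ℕ → X → ℝ}
    (hf : ∀ j, MemLp (f j) ⊤ μ)
    (hb : ∀ g : X → ℝ, Integrable g μ → ∃ C, ∀ j, |∫ x, f j x * g x ∂μ| ≤ C) :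
    ∃ M, ∀ j, ∀ᵐ x ∂μ, |f j x| ≤ M := by
  have hmul : ∀ j (g : X → ℝ), Integrable g μ → Integrable (fun x => f j x * g x) μ :=
    fun j g hg => hg.bdd_mul (hf j).1 (ae_norm_le_toReal_eLpNorm (hf j))
  let T : ℕ → (X →₁[μ] ℝ) →L[ℝ] ℝ := fun j =>
    LinearMap.mkContinuous
      { toFun := fun g => ∫ x, f j x * g x ∂μ
        map_add' := by
          intro g g'
          rw [← integral_add (hmul j g (L1.integrable_coeFn g)) (hmul j g' (L1.integrable_coeFn g'))]
          refine integral_congr_ae ?_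
          filter_upwards [Lp.coeFn_add g g'] with x hx
          rw [hx, Pi.add_apply, mul_add]
        map_smul' := by
          intro c g
          rw [RingHom.id_apply, smul_eq_mul, ← integral_const_mul]
          refine integral_congr_ae ?_
          filter_upwards [Lp.coeFn_smul c g] with x hx
          rw [hx, Pi.smul_apply, smul_eq_mul]
          ring }
      (eLpNorm (f j) ⊤ μ).toReal (by
        intro g
        rw [L1.norm_eq_integral_norm, ← integral_const_mul]
        refine norm_integral_le_of_norm_le ((L1.integrable_coeFn g).norm.const_mul _) ?_
        filter_upwards [ae_norm_le_toReal_eLpNorm (hf j)] with x hx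
        rw [norm_mul]
        exact mul_le_mul_of_nonneg_right hx (norm_nonneg _))
  have hT : ∀ j (g : X →₁[μ] ℝ), T j g = ∫ x, f j x * g x ∂μ := fun j g => rfl
  obtain ⟨M, hM⟩ := banach_steinhaus (g := T) fun g => hb g (L1.integrable_coeFn g)
  -- The uniform operator bound on `L¹`, tested on indicators, bounds every average of `f j` by `M`,
  -- which forces the pointwise bound.
  have hset : ∀ j s, MeasurableSet s → |∫ x in s, f j x ∂μ| ≤ ∫ _ in s, M ∂μ := by
    intro j s hs
    have h1 : T j (indicatorConstLp 1 hs (measure_ne_top μ s) (1 : ℝ)) = ∫ x in s, f j x ∂μ := by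
      rw [hT, ← integral_indicator hs]
      refine integral_congr_ae ?_
      filter_upwards [indicatorConstLp_coeFn (p := 1) (hs := hs) (hμs := measure_ne_top μ s)
        (c := (1 : ℝ))] with x hx
      rw [hx]
      by_cases hxs : x ∈ s <;> simp [hxs]
    have h2 := (T j).le_of_opNorm_le (hM j) (indicatorConstLp 1 hs (measure_ne_top μ s) (1 : ℝ))
    rw [h1, norm_indicatorConstLp one_ne_zero ENNReal.one_ne_top] at h2
    rw [setIntegral_const, smul_eq_mul, mul_comm]
    simpa using h2
  have hint : ∀ j, Integrable (f j) μ := fun j => (hf j).integrable le_top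
  refine ⟨M, fun j => ?_⟩
  have hle : f j ≤ᵐ[μ] fun _ => M :=
    ae_le_of_forall_setIntegral_le (hint j) (integrable_const M) fun s hs _ =>
      (le_abs_self _).trans (hset j s hs)
  have hge : (fun x => -f j x) ≤ᵐ[μ] fun _ => M :=
    ae_le_of_forall_setIntegral_le (hint j).neg (integrable_const M) fun s hs _ => by
      rw [integral_neg]
      exact (neg_le_abs _).trans (hset j s hs)
  filter_upwards [hle, hge] with x h1 h2
  exact abs_le.2 ⟨by linarith, h1⟩

/-- Round a measurable representative of `v` down to the lattice `θ ℤᵏ`. Boundedness leaves finitely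
many cells up to a null set. -/
theorem exists_finite_measurable_partition [IsFiniteMeasure μ] {k : ℕ} {v : X → Fin k → ℝ}
    (hv : AEStronglyMeasurable v μ) {M : ℝ} (hM : ∀ᵐ x ∂μ, ‖v x‖ ≤ M) {θ : ℝ} (hθ : 0 < θ) :
    ∃ (t : Finset (Fin k → ℤ)) (A : (Fin k → ℤ) → Set X) (z : (Fin k → ℤ) → Fin k → ℝ),
      (∀ y ∈ t, MeasurableSet (A y)) ∧ (t : Set (Fin k → ℤ)).Pairwise (Function.onFun Disjoint A) ∧
      (⋃ y ∈ t, A y) =ᵐ[μ] Set.univ ∧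
      ∀ y ∈ t, ∀ᵐ x ∂μ, x ∈ A y → dist (z y) (v x) ≤ θ := by
  let v' : X → Fin k → ℝ := hv.mk v
  have hv' : Measurable v' := hv.stronglyMeasurable_mk.measurable
  let Y : X → Fin k → ℤ := fun x i => ⌊v' x i / θ⌋
  have hY : Measurable Y := measurable_pi_iff.2 fun i =>
    Int.measurable_floor.comp (((measurable_pi_apply i).comp hv').div_const θ)
  let N : ℤ := ⌈M / θ⌉ + 1
  refine ⟨Fintype.piFinset fun _ => Finset.Icc (-N) N, fun y => Y ⁻¹' {y}, fun y i => θ * y i,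
    fun y _ => hY (measurableSet_singleton y), ?_, ?_, ?_⟩
  · intro y _ y' _ hyy'
    exact Disjoint.preimage Y (Set.disjoint_singleton.2 hyy')
  · rw [eventuallyEq_univ]
    filter_upwards [hM, hv.ae_eq_mk] with x hx hxv
    refine Set.mem_iUnion₂.2 ⟨Y x, ?_, rfl⟩
    rw [Fintype.mem_piFinset]
    intro i
    have h1 : |v' x i| ≤ M := by
      have := (norm_le_pi_norm (v x) i).trans hx
      rwa [hxv] at this
    have h2 : |v' x i / θ| ≤ ⌈M / θ⌉ := by
      rw [abs_div, abs_of_pos hθ]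
      exact (div_le_div_of_nonneg_right h1 hθ.le).trans (Int.le_ceil _)
    rw [abs_le] at h2
    rw [Finset.mem_Icc]
    constructor
    · refine Int.le_floor.2 ?_
      simp only [N]
      push_cast
      linarith
    · have h3 : ((⌊v' x i / θ⌋ : ℤ) : ℝ) ≤ (N : ℝ) := by
        simp only [N]
        push_cast
        linarith [Int.floor_le (v' x i / θ)]
      exact_mod_cast h3
  · intro y _
    filter_upwards [hv.ae_eq_mk] with x hxv hxy
    rw [hxv, dist_pi_le_iff hθ.le]
    intro i
    have h1 : y i = ⌊v' x i / θ⌋ := (congrFun hxy i).symm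
    have h2 := Int.floor_le (v' x i / θ)
    have h3 := (Int.lt_floor_add_one (v' x i / θ)).le
    rw [le_div_iff₀ hθ] at h2
    rw [div_le_iff₀ hθ] at h3
    rw [h1, Real.dist_eq, abs_le]
    change -θ ≤ θ * (⌊v' x i / θ⌋ : ℝ) - v' x i ∧ θ * (⌊v' x i / θ⌋ : ℝ) - v' x i ≤ θ
    constructor <;> linarith

/-- Lower semicontinuity along `g j` with limit `v` follows from lower semicontinuity along the
translates `z + (g j - v)` with constant limits `z`, on all measurable sets. -/
theorem eventually_integral_ge_of_forall_const [IsFiniteMeasure μ] {k : ℕ}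
    {F : (Fin k → ℝ) → ℝ} (hF : Continuous F) {g : ℕ → X → Fin k → ℝ} {v : X → Fin k → ℝ}
    (hg : ∀ j, AEStronglyMeasurable (g j) μ) (hv : AEStronglyMeasurable v μ) {M : ℝ}
    (hgM : ∀ j, ∀ᵐ x ∂μ, ‖g j x‖ ≤ M) (hvM : ∀ᵐ x ∂μ, ‖v x‖ ≤ M)
    (hconst : ∀ A, MeasurableSet A → ∀ (z : Fin k → ℝ) (κ : ℝ), 0 < κ →
      ∀ᶠ j in atTop, -κ ≤ ∫ x in A, (F (z + (g j x - v x)) - F z) ∂μ)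
    {κ : ℝ} (hκ : 0 < κ) :
    ∀ᶠ j in atTop, (∫ x, F (v x) ∂μ) - κ ≤ ∫ x, F (g j x) ∂μ := by
  -- The modulus `κ'` is spent twice per point, once for `F (z y)` against `F (v x)` and once for
  -- the translated value against `F (g j x)`. The total is at most `κ / 2`; the other half is
  -- shared among the pieces through `κt`.
  let κ' : ℝ := κ / (4 * (μ.real Set.univ + 1))
  have hκ' : 0 < κ' := by positivity
  obtain ⟨τ, hτ, hFτ⟩ := Metric.uniformContinuousOn_iff.1
    ((isCompact_closedBall (0 : Fin k → ℝ) (M + 1)).uniformContinuousOn_of_continuous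
      hF.continuousOn) κ' hκ'
  have hmin : 0 < min τ 1 := lt_min hτ one_pos
  obtain ⟨t, A, z, hA, hdisj, hcover, hz⟩ :=
    exists_finite_measurable_partition hv hvM (half_pos hmin)
  have hθτ : min τ 1 / 2 < τ := (half_lt_self hmin).trans_le (min_le_left _ _)
  have hθ1 : min τ 1 / 2 ≤ 1 := (half_lt_self hmin).le.trans (min_le_right _ _)
  have hFclose : ∀ a b : Fin k → ℝ, ‖b‖ ≤ M → dist a b ≤ min τ 1 / 2 → |F a - F b| ≤ κ' := by
    intro a b hb hab
    have ha : ‖a‖ ≤ M + 1 := by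
      have h1 := norm_le_norm_add_norm_sub b a
      rw [← dist_eq_norm, dist_comm] at h1
      linarith
    have := hFτ a (mem_closedBall_zero_iff.2 ha) b (mem_closedBall_zero_iff.2 (by linarith))
      (hab.trans_lt hθτ)
    rw [Real.dist_eq] at this
    exact this.le
  let κt : ℝ := κ / (2 * (t.card + 1))
  have hκt : 0 < κt := by positivity
  have hev : ∀ᶠ j in atTop, ∀ y ∈ t,
      -κt ≤ ∫ x in A y, (F (z y + (g j x - v x)) - F (z y)) ∂μ :=
    (Finset.eventually_all t).2 fun y hy => hconst (A y) (hA y hy) (z y) κt hκt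
  have hiv : Integrable (fun x => F (v x)) μ := integrable_comp_of_bound hF hv hvM
  filter_upwards [hev] with j hj
  have hig : Integrable (fun x => F (g j x)) μ := integrable_comp_of_bound hF (hg j) (hgM j)
  have hpiece : ∀ y ∈ t, -κt - 2 * κ' * μ.real (A y) ≤ ∫ x in A y, (F (g j x) - F (v x)) ∂μ := by
    intro y hy
    have hbz : ∀ᵐ x ∂μ, ‖z y + (g j x - v x)‖ ≤ ‖z y‖ + (M + M) := by
      filter_upwards [hgM j, hvM] with x h1 h2
      exact (norm_add_le _ _).trans
        (add_le_add le_rfl ((norm_sub_le _ _).trans (add_le_add h1 h2)))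
    have hiz : Integrable (fun x => F (z y + (g j x - v x)) - F (z y)) μ :=
      (integrable_comp_of_bound hF (aestronglyMeasurable_const.add ((hg j).sub hv)) hbz).sub
        (integrable_const _)
    have h1 : ∫ x in A y, (F (z y + (g j x - v x)) - F (z y) - 2 * κ') ∂μ ≤
        ∫ x in A y, (F (g j x) - F (v x)) ∂μ := by
      refine integral_mono_ae (hiz.sub (integrable_const _)).integrableOn
        (hig.sub hiv).integrableOn ?_
      filter_upwards [ae_restrict_mem (hA y hy), ae_restrict_of_ae (hz y hy),
        ae_restrict_of_ae (hgM j), ae_restrict_of_ae hvM] with x hxA hxz hxg hxv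
      have hd := hxz hxA
      have h2 := hFclose (z y) (v x) hxv hd
      -- The difference of the two arguments is again `z y - v x`.
      have h3 := hFclose (z y + (g j x - v x)) (g j x) hxg (by
        rw [dist_eq_norm] at hd ⊢
        convert hd using 2
        abel)
      rw [abs_le] at h2 h3
      linarith
    rw [integral_sub hiz.integrableOn (integrable_const _), setIntegral_const, smul_eq_mul] at h1
    linarith [hj y hy]
  have hsum : ∫ x, (F (g j x) - F (v x)) ∂μ = ∑ y ∈ t, ∫ x in A y, (F (g j x) - F (v x)) ∂μ := by
    have hi : Integrable (fun x => F (g j x) - F (v x)) μ := hig.sub hiv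
    rw [← integral_biUnion_finset t hA hdisj fun y _ => hi.integrableOn,
      setIntegral_congr_set hcover, setIntegral_univ]
  have hmeas : ∑ y ∈ t, μ.real (A y) = μ.real Set.univ := by
    rw [← measureReal_biUnion_finset hdisj hA, measureReal_congr hcover]
  have htotal : ∑ y ∈ t, (-κt - 2 * κ' * μ.real (A y)) ≤ ∫ x, (F (g j x) - F (v x)) ∂μ := by
    rw [hsum]
    exact Finset.sum_le_sum hpiece
  rw [Finset.sum_sub_distrib, ← Finset.mul_sum, hmeas, Finset.sum_const, nsmul_eq_mul,
    integral_sub hig hiv] at htotal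
  have h1 : t.card * κt ≤ κ / 2 := by
    calc t.card * κt ≤ (t.card + 1) * κt := mul_le_mul_of_nonneg_right (by linarith) hκt.le
      _ = κ / 2 := by
        simp only [κt]
        field_simp
  have h2 : 2 * κ' * μ.real Set.univ ≤ κ / 2 := by
    calc 2 * κ' * μ.real Set.univ ≤ 2 * κ' * (μ.real Set.univ + 1) :=
          mul_le_mul_of_nonneg_left (by linarith) (by positivity)
      _ = κ / 2 := by
        have : μ.real Set.univ + 1 ≠ 0 := by positivity
        simp only [κ']
        field_simp
        norm_num
  linarith

end Measure

/-! ### Consequences of weak-* and uniform convergence -/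

section Limit

variable {n k k' : ℕ} {Ω : Opens (Rn n)}

/-- Testing with fields having one nonzero component gives convergent, hence bounded, scalar
pairings; uniform boundedness then applies to each component. -/
theorem WeakStarTendsto.exists_ae_bound (hΩ : Bornology.IsBounded (Ω : Set (Rn n)))
    {v : ℕ → Rn n → Fin k → ℝ} {v₀ : Rn n → Fin k → ℝ} (hv : WeakStarTendsto Ω v v₀) :
    ∃ M, 0 ≤ M ∧ (∀ j, ∀ᵐ x ∂volume.restrict (Ω : Set (Rn n)), ‖v j x‖ ≤ M) ∧
      ∀ᵐ x ∂volume.restrict (Ω : Set (Rn n)), ‖v₀ x‖ ≤ M := by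
  have hfin := isFiniteMeasure_restrict hΩ
  have hcomp : ∀ i, ∃ M, ∀ j, ∀ᵐ x ∂volume.restrict (Ω : Set (Rn n)), |v j x i| ≤ M := by
    intro i
    refine exists_ae_bound_of_forall_integral_mul_bounded (fun j => (hv.1 j).eval i) ?_
    intro g hg
    have hlim := hv.2.2 (fun x => Pi.single i (g x)) (by
      refine MemLp.of_eval fun i' => ?_
      by_cases hi : i' = i
      · subst hi
        simpa using memLp_one_iff_integrable.2 hg
      · simp [Pi.single_eq_of_ne hi])
    simp only [dotProduct_single] at hlim
    obtain ⟨C, hC⟩ := hlim.abs.bddAbove_range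
    exact ⟨C, fun j => hC ⟨j, rfl⟩⟩
  choose M hM using hcomp
  let M₀ : ℝ := (eLpNorm v₀ ⊤ (volume.restrict (Ω : Set (Rn n)))).toReal
  have hsum0 : 0 ≤ ∑ i, |M i| := Finset.sum_nonneg fun i _ => abs_nonneg _
  have hM₀ : 0 ≤ M₀ := ENNReal.toReal_nonneg
  refine ⟨∑ i, |M i| + M₀, add_nonneg hsum0 hM₀, fun j => ?_, ?_⟩
  · filter_upwards [ae_all_iff.2 fun i => hM i j] with x hx
    refine (pi_norm_le_iff_of_nonneg (add_nonneg hsum0 hM₀)).2 fun i => ?_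
    have h1 : |M i| ≤ ∑ i, |M i| :=
      Finset.single_le_sum (f := fun i => |M i|) (fun i _ => abs_nonneg _) (Finset.mem_univ i)
    rw [Real.norm_eq_abs]
    linarith [hx i, le_abs_self (M i)]
  · filter_upwards [ae_norm_le_toReal_eLpNorm hv.2.1] with x hx
    exact hx.trans (by simp only [M₀]; linarith)

theorem IsGivenBy.sub {T T' : 𝓓'(Ω, ℝ)} {f f' : Rn n → ℝ} (hT : IsGivenBy T f)
    (hT' : IsGivenBy T' f') (hf : IntegrableOn f (Ω : Set (Rn n)))
    (hf' : IntegrableOn f' (Ω : Set (Rn n))) : IsGivenBy (T - T') fun x => f x - f' x := by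
  refine ⟨hT.1.sub hT'.1, fun φ => ?_⟩
  obtain ⟨C, hC⟩ := φ.continuous.bounded_above_of_compact_support φ.hasCompactSupport
  have hφ : ∀ g : Rn n → ℝ, IntegrableOn g (Ω : Set (Rn n)) →
      IntegrableOn (fun x => g x * φ x) (Ω : Set (Rn n)) := fun g hg =>
    Integrable.mul_bdd (c := C) hg φ.continuous.aestronglyMeasurable (Eventually.of_forall hC)
  have h1 : (T - T') φ = T φ - T' φ := rfl
  rw [h1, hT.2, hT'.2, ← integral_sub (hφ f hf) (hφ f' hf')]
  simp only [sub_mul]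

/-- Finiteness makes the smallness of the lower-order derivatives simultaneous: one threshold in `j`
serves all multi-indices. -/
theorem finite_setOf_degree_lt (m : ℕ) : {β : Fin n →₀ ℕ | β.degree < m}.Finite := by
  refine (Set.finite_Icc 0 (Finsupp.equivFunOnFinite.symm fun _ : Fin n => m)).subset ?_
  intro β hβ
  refine ⟨zero_le, fun i => ?_⟩
  exact (Finsupp.le_degree i β).trans (le_of_lt hβ)

theorem LinftyTendsto.eventually_bound {T : ℕ → 𝓓'(Ω, ℝ)} {T₀ : 𝓓'(Ω, ℝ)}
    (hT : LinftyTendsto T T₀) {ε : ℝ} (hε : 0 < ε) :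
    ∀ᶠ j in atTop, ∃ f, IsGivenBy (T j - T₀) f ∧
      ∀ᵐ x ∂volume.restrict (Ω : Set (Rn n)), |f x| ≤ ε := by
  obtain ⟨f, hf, hlim⟩ := hT
  have hev : ∀ᶠ j in atTop, eLpNorm (f j) ⊤ (volume.restrict (Ω : Set (Rn n))) ≤
      ENNReal.ofReal ε :=
    (hlim.eventually (gt_mem_nhds (ENNReal.ofReal_pos.2 hε))).mono fun j hj => hj.le
  filter_upwards [hev] with j hj
  exact ⟨f j, (hf j).2, ae_norm_le_of_eLpNorm_top_le hε.le hj⟩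

end Limit

end SyzygyLSC

end

/-! ### The lower semicontinuity theorem -/

open SyzygyLSC

theorem mainTheorem6 {n k k' : ℕ}
    (S : Matrix (Fin k) (Fin k') (MvPolynomial (Fin n) ℝ)) (h : Fin k' → ℕ)
    (hS : ∀ i l, (S i l).IsHomogeneous (h l))
    (Ω : Opens (SyzygyLSC.Rn n)) (hΩb : Bornology.IsBounded (Ω : Set (SyzygyLSC.Rn n)))
    (hΩc : Convex ℝ (Ω : Set (SyzygyLSC.Rn n)))
    (𝒰 : Set (Fin k' → 𝓓'(Ω, ℝ)))
    (hcomp : SyzygyLSC.CompactnessAssumption S h Ω 𝒰)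
    (F : (Fin k → ℝ) → ℝ) (hF : Continuous F) (hqc : SyzygyLSC.Quasiconvex S F)
    (u : ℕ → Fin k' → SyzygyLSC.Rn n → ℝ) (U : Fin k' → 𝓓'(Ω, ℝ)) (hU : U ∈ 𝒰)
    (v : SyzygyLSC.Rn n → Fin k → ℝ) (hconv : SyzygyLSC.ImageTendsto S Ω u U v) :
    (∀ j, IntegrableOn (fun x => F (SyzygyLSC.applyFun S (u j) x))
      (Ω : Set (SyzygyLSC.Rn n))) ∧
    IntegrableOn (fun x => F (v x)) (Ω : Set (SyzygyLSC.Rn n)) ∧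
    ((∫ x in (Ω : Set (SyzygyLSC.Rn n)), F (v x) : ℝ) : EReal) ≤
      liminf (fun j => ((∫ x in (Ω : Set (SyzygyLSC.Rn n)),
        F (SyzygyLSC.applyFun S (u j) x) : ℝ) : EReal)) atTop := by
  have hfin := isFiniteMeasure_restrict hΩb
  obtain ⟨M, hM0, huM, hvM⟩ := hconv.weakStar.exists_ae_bound hΩb
  have hum : ∀ j, AEStronglyMeasurable (applyFun S (u j)) (volume.restrict (Ω : Set (Rn n))) :=
    fun j => (hconv.weakStar.1 j).1
  have hvm : AEStronglyMeasurable v (volume.restrict (Ω : Set (Rn n))) := hconv.weakStar.2.1.1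
  refine ⟨fun j => integrable_comp_of_bound hF (hum j) (huM j),
    integrable_comp_of_bound hF hvm hvM, ?_⟩
  obtain ⟨u', U', hu', hU', hlow⟩ := hcomp u U v hU hconv
  -- The new potentials have the same images as the old ones, so their difference is a potential of
  -- `S u_j - v`.
  have hgiven : ∀ j i, IsGivenBy (applyDist S (u' j - U') i)
      fun x => (applyFun S (u j) x - v x) i := by
    intro j i
    rw [applyDist_sub, hU']
    exact (hu' j i).sub (hconv.limit i)
      (((hconv.weakStar.1 j).eval i).integrable le_top)
      ((hconv.weakStar.2.1.eval i).integrable le_top)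
  have hdM : ∀ j, ∀ᵐ x ∂volume.restrict (Ω : Set (Rn n)),
      ‖applyFun S (u j) x - v x‖ ≤ M + M := by
    intro j
    filter_upwards [huM j, hvM] with x h1 h2
    exact (norm_sub_le _ _).trans (add_le_add h1 h2)
  have hlow' : ∀ ε > 0, ∀ᶠ j in atTop, ∀ l (β : Fin n →₀ ℕ), β.degree < h l →
      ∃ f, IsGivenBy (multiDeriv partialDist β ((u' j - U') l)) f ∧
        ∀ᵐ x ∂volume.restrict (Ω : Set (Rn n)), |f x| ≤ ε := by
    intro ε hε
    refine eventually_all.2 fun l => (finite_setOf_degree_lt (h l)).eventually_all.2 ?_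
    intro β hβ
    filter_upwards [(hlow l β hβ).eventually_bound hε] with j hj
    rwa [Pi.sub_apply, multiDeriv_partialDist_sub]
  have hmain : ∀ κ > 0, ∀ᶠ j in atTop, (∫ x in (Ω : Set (Rn n)), F (v x)) - κ ≤
      ∫ x in (Ω : Set (Rn n)), F (applyFun S (u j) x) := by
    intro κ hκ
    refine eventually_integral_ge_of_forall_const hF hum hvm huM hvM ?_ hκ
    intro A hA z ε hε
    rw [Measure.restrict_restrict hA]
    exact hqc.eventually_setIntegral_ge hS hΩb hF (add_nonneg hM0 hM0) hgiven
      (fun j => (hum j).sub hvm) hdM hlow' (hA.inter Ω.isOpen.measurableSet)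
      Set.inter_subset_right z hε
  -- Any extended real `c` below the limit integral lies below some real `r` still below it, and the
  -- gap above `r` serves as `κ`.
  refine le_of_forall_lt fun c hc => ?_
  obtain ⟨r, hcr, hr⟩ := EReal.lt_iff_exists_real_btwn.1 hc
  refine hcr.trans_le (le_liminf_of_le (by isBoundedDefault) ?_)
  filter_upwards [hmain _ (sub_pos.2 (EReal.coe_lt_coe_iff.1 hr))] with j hj
  exact EReal.coe_le_coe_iff.2 (by linarith)
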